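/- Let $\mathbb K\in\{\mathbb R,\mathbb C\}$, let $\mathfrak g$ be a finite dimensional real vector space (for instance the Lie algebra of a compact torus) and let $X=(a_1,\dots,a_m)$ be a finite list of nonzero vectors (repetitions allowed) spanning $\mathfrak g^*$ (for instance nonzero characters of the torus). Let $\mathcal S'(V)$ denote the space of $\mathbb K$-valued tempered distributions on a finite dimensional real vector space $V$, and let $S[\mathfrak g^*]$ be the symmetric algebra of $\mathfrak g^*$, with coefficients in $\mathbb K$, acting on $\mathcal S'(\mathfrak g^*)$ by differential operators with constant coefficients, where $a\in\mathfrak g^*$ acts as the directional derivative $\partial_a$. A subspace $\underline r\subset\mathfrak g^*$ is called rational if it is spanned by the members of $X$ lying in it. For such $\underline r$ put $\partial_{X\setminus\underline r}=\prod_{i:\,a_i\notin\underline r}\partial_{a_i}$, and let $\mathcal S'(\mathfrak g^*,\underline r)\subset\mathcal S'(\mathfrak g^*)$ be the image of $\mathcal S'(\underline r)$ under $j(\phi)(f)=\phi(f|_{\underline r})$. Let $$\mathcal G(X)=\{f\in\mathcal S'(\mathfrak g^*)\mid \partial_{X\setminus\underline r}f\in\mathcal S'(\mathfrak g^*,\underline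 r)\ \text{for all rational subspaces } \underline r\},$$ and let $\tilde{\mathcal G}(X)=S[\mathfrak g^*]\,\mathcal G(X)$ be the $S[\mathfrak g^*]$-submodule of $\mathcal S'(\mathfrak g^*)$ generated by $\mathcal G(X)$. A regular face $F$ for $X$ is a connected component of $\{x\in\mathfrak g\mid \langle a_i,x\rangle\neq0 \text{ for all } i\}$. Given $F$, let $A$ (resp. $B$) be the sublist of the members of $X$ that are positive (resp. negative) on $F$, and let $(A,-B)=(b_1,\dots,b_m)$ with $b_i=a_i$ if $a_i$ is positive on $F$ and $b_i=-a_i$ otherwise. Let $T_X^F\in\mathcal S'(\mathfrak g^*)$ be the tempered distribution $$\langle T_X^F\mid f\rangle=(-1)^{|B|}\int_0^\infty\!\!\cdots\int_0^\infty f\Big(\sum_{i=1}^m t_ib_i\Big)\,dt_1\cdots dt_m .$$ Then the $S[\mathfrak g^*]$-module $\tilde{\mathcal G}(X)$ is generated by the distributions $T_X^F$: $$\tilde{\mathcal G}(X)=\sum_F S[\mathfrak g^*]\,T_X^F,$$ where $F$ runs over all regular faces for $X$. -/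

import Mathlib

noncomputable section

open scoped TensorProduct SchwartzMap LineDeriv IsMulCommutative

namespace SplineModule

section Distributions

variable (𝕜 : Type*) [RCLike 𝕜] (V : Type*) [NormedAddCommGroup V] [NormedSpace ℝ V]

/-- Tempered distributions on `V` with scalars `𝕜 = ℝ` or `ℂ`. For `𝕜 = ℂ` this is Mathlib's
`TemperedDistribution V ℂ`. -/
abbrev TempDist : Type _ := 𝓢(V, 𝕜) →Lₚₜ[𝕜] 𝕜

/-- The symmetric algebra `S[V]` with scalars extended to `𝕜`. -/
abbrev SymAlg : Type _ := SymmetricAlgebra 𝕜 (𝕜 ⊗[ℝ] V)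

variable {V}

/-- The derivative `∂_a` of tempered distributions in the direction `a`,
`⟨∂_a T | f⟩ = ⟨T | -∂_a f⟩`. -/
def distDeriv (a : V) : Module.End 𝕜 (TempDist 𝕜 V) :=
  (PointwiseConvergenceCLM.precomp 𝕜
    (-LineDeriv.lineDerivOpCLM 𝕜 𝓢(V, 𝕜) a)).toLinearMap

variable {𝕜}

@[simp]
theorem distDeriv_apply (a : V) (T : TempDist 𝕜 V) (f : 𝓢(V, 𝕜)) :
    distDeriv 𝕜 a T f = T (-∂_{a} f) := rfl

theorem schwartz_lineDeriv_comm (a b : V) (f : 𝓢(V, 𝕜)) : ∂_{a} (∂_{b} f) = ∂_{b} (∂_{a} f) := by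
  ext x
  have key : ∀ v w : V, (∂_{v} (∂_{w} f)) x = fderiv ℝ (fderiv ℝ f) x v w := by
    intro v w
    rw [SchwartzMap.lineDerivOp_apply_eq_fderiv]
    have h : ((∂_{w} f : 𝓢(V, 𝕜)) : V → 𝕜) = fun y => fderiv ℝ f y w := by
      ext y
      rw [SchwartzMap.lineDerivOp_apply_eq_fderiv]
    rw [h, fderiv_clm_apply _ (differentiableAt_const w)]
    · simp
    · exact ((f.smooth 2).fderiv_right (m := 1) (by norm_num)).differentiable (by norm_num) x
  rw [key, key]
  exact ((f.smooth 2).contDiffAt.isSymmSndFDerivAt (by simp)) a b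

theorem distDeriv_comm (a b : V) :
    distDeriv 𝕜 a * distDeriv 𝕜 b = distDeriv 𝕜 b * distDeriv 𝕜 a := by
  ext T f
  simp only [Module.End.mul_apply, distDeriv_apply, LineDeriv.lineDerivOp_neg,
    schwartz_lineDeriv_comm a b]

theorem distDeriv_add (a b : V) : distDeriv 𝕜 (a + b) = distDeriv 𝕜 a + distDeriv 𝕜 b := by
  ext T f
  simp [LineDeriv.lineDerivOp_left_add, add_comm]

theorem distDeriv_smul (c : ℝ) (a : V) :
    distDeriv 𝕜 (c • a) = algebraMap ℝ 𝕜 c • distDeriv 𝕜 a := by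
  ext T f
  have h : (∂_{c • a} f : 𝓢(V, 𝕜)) = (algebraMap ℝ 𝕜 c) • ∂_{a} f := by
    rw [LineDeriv.lineDerivOp_left_smul]
    ext x
    simp [RCLike.real_smul_eq_coe_mul]
  rw [distDeriv_apply, h, ← smul_neg, map_smul]
  rfl

variable (𝕜 V)

/-- The algebra of differential operators with constant coefficients acting on `TempDist 𝕜 V`. -/
def diffOpAlg : Subalgebra 𝕜 (Module.End 𝕜 (TempDist 𝕜 V)) :=
  Algebra.adjoin 𝕜 (Set.range (distDeriv 𝕜))

instance : IsMulCommutative (diffOpAlg 𝕜 V) :=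
  Algebra.isMulCommutative_adjoin 𝕜 (by
    rintro _ ⟨a, rfl⟩ _ ⟨b, rfl⟩
    exact distDeriv_comm a b)

/-- `1 ⊗ a ↦ ∂_a`, with values in the algebra of constant coefficient operators. -/
def symbolMap : 𝕜 ⊗[ℝ] V →ₗ[𝕜] diffOpAlg 𝕜 V :=
  LinearMap.liftBaseChange 𝕜
    { toFun := fun a => (⟨distDeriv 𝕜 a, Algebra.subset_adjoin (Set.mem_range_self a)⟩ : diffOpAlg 𝕜 V)
      map_add' := fun a b => Subtype.ext (distDeriv_add a b)
      map_smul' := fun c a => Subtype.ext ((distDeriv_smul c a).trans (algebraMap_smul 𝕜 c (distDeriv 𝕜 a))) }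

/-- The extension of `1 ⊗ a ↦ ∂_a` to the symmetric algebra. -/
def toDiffOpAlg : SymAlg 𝕜 V →ₐ[𝕜] diffOpAlg 𝕜 V :=
  SymmetricAlgebra.lift (A := diffOpAlg 𝕜 V) (symbolMap 𝕜 V)

/-- The algebra homomorphism sending `a ∈ V` to `∂_a`: it identifies `S[V]` with the differential
operators with constant coefficients. -/
def diffOp : SymAlg 𝕜 V →ₐ[𝕜] Module.End 𝕜 (TempDist 𝕜 V) :=
  (diffOpAlg 𝕜 V).val.comp (toDiffOpAlg 𝕜 V)

/-- `S[V]` acts on tempered distributions by differential operators with constant coefficients. -/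
instance : Module (SymAlg 𝕜 V) (TempDist 𝕜 V) :=
  Module.compHom (TempDist 𝕜 V) (diffOp 𝕜 V).toRingHom

variable {𝕜 V}

theorem smul_eq_diffOp (p : SymAlg 𝕜 V) (T : TempDist 𝕜 V) : p • T = diffOp 𝕜 V p T := rfl

variable (𝕜)

/-- A vector `a ∈ V` as an element of `S[V]`. -/
def lin (a : V) : SymAlg 𝕜 V := SymmetricAlgebra.ι 𝕜 (𝕜 ⊗[ℝ] V) (1 ⊗ₜ[ℝ] a)

variable {𝕜}

theorem lin_smul (a : V) (T : TempDist 𝕜 V) : lin 𝕜 a • T = distDeriv 𝕜 a T := by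
  have h : toDiffOpAlg 𝕜 V (lin 𝕜 a) = symbolMap 𝕜 V (1 ⊗ₜ[ℝ] a) :=
    SymmetricAlgebra.lift_ι_apply (A := diffOpAlg 𝕜 V) (symbolMap 𝕜 V) (1 ⊗ₜ[ℝ] a)
  rw [smul_eq_diffOp, diffOp, AlgHom.comp_apply, h, symbolMap, LinearMap.liftBaseChange_tmul,
    one_smul]
  rfl

variable (𝕜)

/-- Restriction of Schwartz functions to a subspace. -/
def restrict (r : Submodule ℝ V) : 𝓢(V, 𝕜) →L[𝕜] 𝓢(r, 𝕜) :=
  SchwartzMap.compCLMOfAntilipschitz 𝕜 (K := 1) (g := r.subtypeL)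
    r.subtypeL.hasTemperateGrowth r.subtypeₗᵢ.isometry.antilipschitz

@[simp]
theorem restrict_apply (r : Submodule ℝ V) (f : 𝓢(V, 𝕜)) (x : r) : restrict 𝕜 r f x = f x := rfl

/-- The map `j : 𝓢'(r) → 𝓢'(V)`, `j φ f = φ (f|r)`. -/
def extend (r : Submodule ℝ V) : TempDist 𝕜 r →ₗ[𝕜] TempDist 𝕜 V :=
  (PointwiseConvergenceCLM.precomp 𝕜 (restrict 𝕜 r)).toLinearMap

@[simp]
theorem extend_apply (r : Submodule ℝ V) (φ : TempDist 𝕜 r) (f : 𝓢(V, 𝕜)) :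
    extend 𝕜 r φ f = φ (restrict 𝕜 r f) := rfl

/-- The space `𝓢'(V, r)`: the image of `j`. -/
def distOn (r : Submodule ℝ V) : Submodule 𝕜 (TempDist 𝕜 V) := LinearMap.range (extend 𝕜 r)

/-- A subspace is rational relative to the list `X` if it is spanned by members of `X`. -/
def IsRational {m : ℕ} (X : Fin m → V) (r : Submodule ℝ V) : Prop :=
  r = Submodule.span ℝ (Set.range X ∩ r)

open scoped Classical in
/-- The product `d_{X ∖ r} ∈ S[V]` of the members of the list `X` that are not in `r`, counted
with multiplicity; it acts on distributions as `∂_{X ∖ r}`. -/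
def dSdiff {m : ℕ} (X : Fin m → V) (r : Submodule ℝ V) : SymAlg 𝕜 V :=
  ∏ i with X i ∉ r, lin 𝕜 (X i)

/-- The space `𝒢(X)` of the tempered distributions `f` such that `∂_{X ∖ r} f ∈ 𝓢'(V, r)` for all
rational subspaces `r`. -/
def spaceG {m : ℕ} (X : Fin m → V) : Submodule 𝕜 (TempDist 𝕜 V) where
  carrier := {f | ∀ r : Submodule ℝ V, IsRational X r → dSdiff 𝕜 X r • f ∈ distOn 𝕜 r}
  add_mem' hf hg r hr := by
    rw [smul_add]
    exact add_mem (hf r hr) (hg r hr)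
  zero_mem' r _ := by
    rw [smul_zero]
    exact zero_mem _
  smul_mem' c f hf r hr := by
    rw [smul_eq_diffOp, map_smul]
    exact Submodule.smul_mem _ c (hf r hr)

/-- The `S[V]`-module `S[V] 𝒢(X)` generated by `𝒢(X)`. -/
def tildeG {m : ℕ} (X : Fin m → V) : Submodule (SymAlg 𝕜 V) (TempDist 𝕜 V) :=
  Submodule.span (SymAlg 𝕜 V) (spaceG 𝕜 X : Set (TempDist 𝕜 V))

end Distributions

section Splines

variable (𝕜 : Type*) [RCLike 𝕜] {E : Type*} [NormedAddCommGroup E] [NormedSpace ℝ E] {m : ℕ}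

theorem spline_lower_bound (a : Fin m → StrongDual ℝ E) (h : ∃ x : E, ∀ i, 0 < a i x) :
    ∃ c : ℝ, 1 ≤ c ∧ ∀ t : Fin m → ℝ, (∀ i, 0 ≤ t i) → 1 + ‖t‖ ≤ c * (1 + ‖∑ i, t i • a i‖) := by
  obtain ⟨x, hx⟩ := h
  have hS : 0 ≤ ∑ i, (a i x)⁻¹ := Finset.sum_nonneg fun i _ => (inv_pos.2 (hx i)).le
  refine ⟨1 + (∑ i, (a i x)⁻¹) * ‖x‖, by nlinarith [norm_nonneg x], fun t ht => ?_⟩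
  have h1 : ‖t‖ ≤ (∑ i, (a i x)⁻¹) * (‖∑ i, t i • a i‖ * ‖x‖) := by
    refine (pi_norm_le_iff_of_nonneg (by positivity)).2 fun i => ?_
    have h2 : t i * a i x ≤ ‖∑ i, t i • a i‖ * ‖x‖ := by
      refine le_trans ?_ ((le_abs_self _).trans ((∑ i, t i • a i).le_opNorm x))
      simp only [sum_apply, smul_apply, smul_eq_mul]
      exact Finset.single_le_sum (f := fun i => t i * a i x)
        (fun j _ => mul_nonneg (ht j) (hx j).le) (Finset.mem_univ i)
    rw [Real.norm_eq_abs, abs_of_nonneg (ht i)]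
    calc t i = (a i x)⁻¹ * (t i * a i x) := by field_simp [(hx i).ne']
      _ ≤ (a i x)⁻¹ * (‖∑ i, t i • a i‖ * ‖x‖) := by
        gcongr
        exact (inv_pos.2 (hx i)).le
      _ ≤ _ := by
        gcongr
        exact Finset.single_le_sum (f := fun i => (a i x)⁻¹)
          (fun j _ => (inv_pos.2 (hx j)).le) (Finset.mem_univ i)
  nlinarith [norm_nonneg x, norm_nonneg (∑ i, t i • a i), mul_nonneg hS (norm_nonneg x)]

/-- The orthant of nonnegative parameters. -/
def orthant (m : ℕ) : Set (Fin m → ℝ) := {t | ∀ i, 0 ≤ t i}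

theorem spline_bound (a : Fin m → StrongDual ℝ E) (h : ∃ x : E, ∀ i, 0 < a i x) :
    ∃ C : ℝ, 0 ≤ C ∧ ∀ f : 𝓢(StrongDual ℝ E, 𝕜), ∀ t ∈ orthant m,
      ‖f (∑ i, t i • a i)‖ ≤ (1 + ‖t‖) ^ (-((m + 1 : ℕ) : ℝ)) *
        (C * (Finset.Iic (m + 1, 0)).sup (schwartzSeminormFamily 𝕜 (StrongDual ℝ E) 𝕜) f) := by
  obtain ⟨c, hc, hb⟩ := spline_lower_bound a h
  refine ⟨c ^ (m + 1) * 2 ^ (m + 1), by positivity, fun f t ht => ?_⟩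
  have h1 := SchwartzMap.one_add_le_sup_seminorm_apply (𝕜 := 𝕜) (m := (m + 1, 0)) (k := m + 1)
    (n := 0) le_rfl le_rfl f (∑ i, t i • a i)
  rw [norm_iteratedFDeriv_zero] at h1
  rw [Real.rpow_neg (by positivity), ← div_eq_inv_mul, le_div_iff₀' (by positivity),
    Real.rpow_natCast]
  calc (1 + ‖t‖) ^ (m + 1) * ‖f (∑ i, t i • a i)‖
      ≤ (c * (1 + ‖∑ i, t i • a i‖)) ^ (m + 1) * ‖f (∑ i, t i • a i)‖ := by
        gcongr
        exact hb t ht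
    _ = c ^ (m + 1) * ((1 + ‖∑ i, t i • a i‖) ^ (m + 1) * ‖f (∑ i, t i • a i)‖) := by
        rw [mul_pow, mul_assoc]
    _ ≤ c ^ (m + 1) * (2 ^ (m + 1) * (Finset.Iic (m + 1, 0)).sup
          (schwartzSeminormFamily 𝕜 (StrongDual ℝ E) 𝕜) f) := by
        exact mul_le_mul_of_nonneg_left h1 (by positivity)
    _ = _ := by ring

theorem measurableSet_orthant : MeasurableSet (orthant m) := by
  have : orthant m = Set.Ici 0 := by
    ext t
    simp [orthant, Pi.le_def]
  rw [this]
  exact isClosed_Ici.measurableSet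

theorem integrable_majorant (c : ℝ) : MeasureTheory.IntegrableOn
    (fun t : Fin m → ℝ => (1 + ‖t‖) ^ (-((m + 1 : ℕ) : ℝ)) * c) (orthant m) :=
  ((integrable_one_add_norm (by simp)).mul_const c).integrableOn

theorem spline_integrable (a : Fin m → StrongDual ℝ E) (h : ∃ x : E, ∀ i, 0 < a i x)
    (f : 𝓢(StrongDual ℝ E, 𝕜)) :
    MeasureTheory.IntegrableOn (fun t : Fin m → ℝ => f (∑ i, t i • a i)) (orthant m) := by
  obtain ⟨C, -, hC⟩ := spline_bound 𝕜 a h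
  refine MeasureTheory.Integrable.mono' (integrable_majorant _) ?_
    ((MeasureTheory.ae_restrict_iff' measurableSet_orthant).2 (Filter.Eventually.of_forall (hC f)))
  have : Continuous fun t : Fin m → ℝ => f (∑ i, t i • a i) := f.continuous.comp (by fun_prop)
  exact this.aestronglyMeasurable

/-- The multivariate spline `T_a` of a list `a` of vectors that are all positive on some `x`:
`⟨T_a | f⟩ = ∫_0^∞ ⋯ ∫_0^∞ f(∑ t_i a_i) dt_1 ⋯ dt_m`. -/
def spline (a : Fin m → StrongDual ℝ E) (h : ∃ x : E, ∀ i, 0 < a i x) :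
    TempDist 𝕜 (StrongDual ℝ E) :=
  ContinuousLinearMap.toPointwiseConvergenceCLM 𝕜 _ _ _
    (SchwartzMap.mkCLMtoNormedSpace (𝕜 := 𝕜) (𝕜' := 𝕜) (σ := RingHom.id 𝕜)
      (fun f : 𝓢(StrongDual ℝ E, 𝕜) => ∫ t in orthant m, f (∑ i, t i • a i))
      (fun f g => MeasureTheory.integral_add (spline_integrable 𝕜 a h f)
        (spline_integrable 𝕜 a h g))
      (fun c f => MeasureTheory.integral_const_mul c _)
      (by
        obtain ⟨C, hC0, hC⟩ := spline_bound 𝕜 a h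
        refine ⟨Finset.Iic (m + 1, 0),
          (∫ t in orthant m, (1 + ‖t‖) ^ (-((m + 1 : ℕ) : ℝ))) * C, ?_, fun f => ?_⟩
        · exact mul_nonneg (MeasureTheory.integral_nonneg fun t => by positivity) hC0
        · rw [mul_assoc, ← MeasureTheory.integral_mul_const]
          exact MeasureTheory.norm_integral_le_of_norm_le (integrable_majorant _)
            ((MeasureTheory.ae_restrict_iff' measurableSet_orthant).2
              (Filter.Eventually.of_forall (hC f)))))

@[simp]
theorem spline_apply (a : Fin m → StrongDual ℝ E) (h : ∃ x : E, ∀ i, 0 < a i x)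
    (f : 𝓢(StrongDual ℝ E, 𝕜)) :
    spline 𝕜 a h f = ∫ t in orthant m, f (∑ i, t i • a i) := rfl

/-- The complement of the arrangement of the hyperplanes `a^⊥`, `a ∈ X`. -/
def arrangementCompl (X : Fin m → StrongDual ℝ E) : Set E := {x | ∀ i, X i x ≠ 0}

/-- The regular faces for `X`: the connected components of the complement of the arrangement. -/
def RegularFace (X : Fin m → StrongDual ℝ E) : Type _ :=
  {F : Set E // ∃ x ∈ arrangementCompl X, F = connectedComponentIn (arrangementCompl X) x}

variable {X : Fin m → StrongDual ℝ E}

theorem RegularFace.sign (F : RegularFace X) (i : Fin m) :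
    (∀ x ∈ F.1, 0 < X i x) ∨ (∀ x ∈ F.1, X i x < 0) := by
  obtain ⟨F, y, hy, rfl⟩ := F
  have hpre : IsPreconnected (X i '' connectedComponentIn (arrangementCompl X) y) :=
    isPreconnected_connectedComponentIn.image _ (X i).continuous.continuousOn
  by_contra! hcon
  obtain ⟨⟨u, hu, hu0⟩, v, hv, hv0⟩ := hcon
  obtain ⟨w, hw, hw0⟩ := hpre.Icc_subset ⟨u, hu, rfl⟩ ⟨v, hv, rfl⟩ ⟨hu0, hv0⟩
  exact connectedComponentIn_subset _ _ hw i hw0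

open scoped Classical in
/-- The sublist `B` of the members of `X` that are negative on the face `F`. -/
def RegularFace.neg (F : RegularFace X) : Finset (Fin m) := {i | ∀ x ∈ F.1, X i x < 0}

/-- The list `(A, -B)`: `X` with the signs of the members of `B` reversed. -/
def RegularFace.flip (F : RegularFace X) (i : Fin m) : StrongDual ℝ E :=
  open scoped Classical in if i ∈ F.neg then -X i else X i

theorem RegularFace.flip_pos (F : RegularFace X) : ∃ x : E, ∀ i, 0 < F.flip i x := by
  have hF := F.2
  obtain ⟨x, hx, hxF⟩ := hF
  have hmem : x ∈ F.1 := hxF ▸ mem_connectedComponentIn hx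
  refine ⟨x, fun i => ?_⟩
  by_cases hi : i ∈ F.neg
  · have : ∀ x ∈ F.1, X i x < 0 := by simpa [RegularFace.neg] using hi
    simpa [RegularFace.flip, hi] using this x hmem
  · have : ¬ ∀ x ∈ F.1, X i x < 0 := by simpa [RegularFace.neg] using hi
    simpa [RegularFace.flip, hi] using ((F.sign i).resolve_right this) x hmem

/-- `T_X^F = (-1)^{|B|} T_{(A,-B)}`. -/
def faceSpline (X : Fin m → StrongDual ℝ E) (F : RegularFace X) : TempDist 𝕜 (StrongDual ℝ E) :=
  ((-1 : 𝕜) ^ F.neg.card) • spline 𝕜 F.flip F.flip_pos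

end Splines

end SplineModule

end

noncomputable section

open scoped TensorProduct SchwartzMap LineDeriv FourierTransform
open MeasureTheory

namespace SplineModule

universe u

/-! ### Schwartz functions: Hadamard's lemma, and primitives of functions of integral zero. -/

section Schwartz

variable {V W F : Type*} [NormedAddCommGroup V] [NormedSpace ℝ V] [NormedAddCommGroup W]
  [NormedSpace ℝ W] [NormedAddCommGroup F] [NormedSpace ℝ F]

/-! Write V for the dual of 𝔤. Each T_X^F is a signed integral over a product of half-lines, and
∂_{a_i} collapses the i-th half-line to its end point. After ∂_{X∖r} only directions in r survive,
so T_X^F lies in 𝒢(X) (`faceSpline_mem_spaceG`).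

For the other inclusion, 𝒢(X) is embedded in a module suited to induction. Being carried by r is
relaxed to: every linear form vanishing on r acts nilpotently. This condition is stable under S[V].
The module `spaceH X ℓ Y` consists of the distributions invariant along the X_i, i ∈ ℓ (an
independent family), that satisfy the relaxed conditions for the list Y and the rational r
containing that family. Its candidate generators `genSet X ℓ Y` are splines with full lines along ℓ
and half-lines along Y, oriented by a linear form ξ vanishing on ℓ.

`spaceH_le_span_genSet` is a strong induction on |Y|. For a ∈ Y, ∂_a f satisfies the conditions for
Y∖a, so it is a combination of generators; each of these is ∂_a of a generator for Y
(`span_genSet_erase_le`), which gives g in the span with ∂_a g = ∂_a f. Then f - g is invariant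
along X_a, so a joins ℓ and Y shrinks; the new generators lie in the old span because a line is a
signed difference of two half-lines (`genSet_insert_subset`).

When Y is empty, Kashiwara's lemma reduces to distributions killed by the equations of span ℓ and
invariant along it. These are multiples of Lebesgue integration on that subspace
(`mem_span_modeSpline_line`). For ℓ = ∅ and Y = X the orienting forms are the regular points of 𝔤,
and the generators are exactly the T_X^F. -/

theorem norm_iteratedFDeriv_comp_fst_le (f : 𝓢(V, F)) (n : ℕ) (p : V × W) :
    ‖iteratedFDeriv ℝ n (fun p : V × W => f p.1) p‖ ≤ ‖iteratedFDeriv ℝ n f p.1‖ := by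
  have h := (ContinuousLinearMap.fst ℝ V W).iteratedFDeriv_comp_right (f.smooth ⊤) p
    (i := n) (by exact_mod_cast le_top)
  have h2 : (f ∘ (ContinuousLinearMap.fst ℝ V W)) = fun p : V × W => f p.1 := rfl
  rw [h2] at h
  rw [h]
  refine (ContinuousMultilinearMap.norm_compContinuousLinearMap_le _ _).trans ?_
  refine mul_le_of_le_one_right (norm_nonneg _) ?_
  exact Finset.prod_le_one (fun _ _ => norm_nonneg _)
    fun _ _ => ContinuousLinearMap.norm_fst_le ℝ V W

theorem norm_iteratedFDeriv_comp_snd_le (f : 𝓢(W, F)) (n : ℕ) (p : V × W) :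
    ‖iteratedFDeriv ℝ n (fun p : V × W => f p.2) p‖ ≤ ‖iteratedFDeriv ℝ n f p.2‖ := by
  have h := (ContinuousLinearMap.snd ℝ V W).iteratedFDeriv_comp_right (f.smooth ⊤) p
    (i := n) (by exact_mod_cast le_top)
  have h2 : (f ∘ (ContinuousLinearMap.snd ℝ V W)) = fun p : V × W => f p.2 := rfl
  rw [h2] at h
  rw [h]
  refine (ContinuousMultilinearMap.norm_compContinuousLinearMap_le _ _).trans ?_
  refine mul_le_of_le_one_right (norm_nonneg _) ?_
  exact Finset.prod_le_one (fun _ _ => norm_nonneg _)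
    fun _ _ => ContinuousLinearMap.norm_snd_le ℝ V W

/-- The Schwartz function `(x, y) ↦ m y • f x` on a product. -/
def tensor (f : 𝓢(V, F)) (m : 𝓢(W, ℝ)) : 𝓢(V × W, F) where
  toFun p := m p.2 • f p.1
  smooth' := ((m.smooth ⊤).comp contDiff_snd).smul ((f.smooth ⊤).comp contDiff_fst)
  decay' k n := by
    choose A _ hA using fun i => f.decay k i
    choose A0 _ hA0 using fun i => f.decay 0 i
    choose B _ hB using fun i => m.decay k i
    choose B0 _ hB0 using fun i => m.decay 0 i
    refine ⟨∑ i ∈ Finset.range (n + 1), (n.choose i : ℝ) *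
      (B0 i * A (n - i) + B i * A0 (n - i)), fun p => ?_⟩
    have h := norm_iteratedFDeriv_smul_le (𝕜 := ℝ) (N := ((⊤ : ℕ∞) : WithTop ℕ∞))
      (f := fun p : V × W => m p.2) (g := fun p : V × W => f p.1)
      ((m.smooth ⊤).comp contDiff_snd) ((f.smooth ⊤).comp contDiff_fst) p (n := n) (by exact_mod_cast le_top)
    have hp : ‖p‖ ^ k ≤ ‖p.1‖ ^ k + ‖p.2‖ ^ k := by
      rcases max_choice ‖p.1‖ ‖p.2‖ with h | h <;> rw [Prod.norm_def, h]
      · exact le_add_of_nonneg_right (by positivity)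
      · exact le_add_of_nonneg_left (by positivity)
    refine (mul_le_mul_of_nonneg_left h (by positivity)).trans ?_
    rw [Finset.mul_sum]
    refine Finset.sum_le_sum fun i _ => ?_
    have h1 := norm_iteratedFDeriv_comp_fst_le f (n - i) p
    have h2 := norm_iteratedFDeriv_comp_snd_le m i p
    set a := ‖iteratedFDeriv ℝ (n - i) f p.1‖
    set b := ‖iteratedFDeriv ℝ i m p.2‖
    have ha : 0 ≤ a := norm_nonneg _
    have hb : 0 ≤ b := norm_nonneg _
    have e1 := hA (n - i) p.1
    have e2 := hA0 (n - i) p.1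
    have e3 := hB i p.2
    have e4 := hB0 i p.2
    rw [pow_zero, one_mul] at e2 e4
    calc _ ≤ (‖p.1‖ ^ k + ‖p.2‖ ^ k) * ((n.choose i : ℝ) * b * a) := by gcongr
      _ = (n.choose i : ℝ) * (b * (‖p.1‖ ^ k * a) + (‖p.2‖ ^ k * b) * a) := by ring
      _ ≤ _ := by
        have : 0 ≤ ‖p.1‖ ^ k * a := by positivity
        have : 0 ≤ ‖p.2‖ ^ k * b := by positivity
        gcongr
        · exact hb.trans e4
        · linarith

@[simp]
theorem tensor_apply (f : 𝓢(V, F)) (m : 𝓢(W, ℝ)) (p : V × W) : tensor f m p = m p.2 • f p.1 := rfl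

theorem exists_schwartz_one [FiniteDimensional ℝ V] : ∃ m : 𝓢(V, ℝ), m 0 = 1 := by
  let b : ContDiffBump (0 : V) := ⟨1, 2, one_pos, one_lt_two⟩
  exact ⟨b.hasCompactSupport.toSchwartzMap b.contDiff, b.one_of_mem_closedBall (by simp [b.rIn_pos.le])⟩

/-- Composition of a Schwartz function with a linear map that has a left inverse. -/
theorem exists_comp_of_leftInverse (Ψ : 𝓢(W, F)) (L : V →L[ℝ] W) (R : W →L[ℝ] V)
    (h : ∀ x, R (L x) = x) : ∃ G : 𝓢(V, F), ∀ x, G x = Ψ (L x) :=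
  ⟨SchwartzMap.compCLMOfAntilipschitz ℝ (K := ‖R‖₊) L.hasTemperateGrowth
    (AntilipschitzWith.of_le_mul_dist fun x y => by
      rw [dist_eq_norm, dist_eq_norm, ← map_sub]
      conv_lhs => rw [← h (x - y)]
      exact R.le_opNorm _) Ψ, fun x => rfl⟩

section ParametricIntegral

variable (q : V →L[ℝ] W)

/-- The graph of `θ q`. -/
def graphCLM (θ : ℝ) : V →L[ℝ] V × W := (ContinuousLinearMap.id ℝ V).prod (θ • q)

@[simp]
theorem graphCLM_apply (θ : ℝ) (x : V) : graphCLM q θ x = (x, θ • q x) := rfl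

theorem continuous_graphCLM : Continuous (graphCLM q) :=
  (ContinuousLinearMap.prodₗᵢ (𝕜 := ℝ) (E := V) (F := V) (G := W) ℝ).continuous.comp
    (Continuous.prodMk continuous_const (continuous_id.smul continuous_const))

variable (Ψ : 𝓢(V × W, F))

theorem iteratedFDeriv_comp_graphCLM (θ : ℝ) (n : ℕ) (x : V) :
    iteratedFDeriv ℝ n (Ψ ∘ graphCLM q θ) x =
      (iteratedFDeriv ℝ n Ψ (graphCLM q θ x)).compContinuousLinearMap fun _ => graphCLM q θ :=
  (graphCLM q θ).iteratedFDeriv_comp_right (Ψ.smooth ⊤) x (by exact_mod_cast le_top)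

theorem contDiff_comp_graphCLM (θ : ℝ) : ContDiff ℝ ((⊤ : ℕ∞) : WithTop ℕ∞) (Ψ ∘ graphCLM q θ) :=
  (Ψ.smooth ⊤).comp (graphCLM q θ).contDiff

theorem continuous_iteratedFDeriv_comp_graphCLM (n : ℕ) :
    Continuous fun p : ℝ × V => iteratedFDeriv ℝ n (Ψ ∘ graphCLM q p.1) p.2 := by
  simp_rw [iteratedFDeriv_comp_graphCLM]
  have h1 := (ContinuousMultilinearMap.compContinuousLinearMapContinuousMultilinear ℝ
    (fun _ : Fin n => V) (fun _ : Fin n => V × W) F).cont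
  have h2 : Continuous fun p : ℝ × V => fun _ : Fin n => graphCLM q p.1 :=
    continuous_pi fun _ => (continuous_graphCLM q).comp continuous_fst
  have h3 : Continuous fun p : ℝ × V => iteratedFDeriv ℝ n Ψ (graphCLM q p.1 p.2) :=
    ((Ψ.smooth ⊤).continuous_iteratedFDeriv (by exact_mod_cast le_top)).comp
      (((continuous_graphCLM q).comp continuous_fst).clm_apply continuous_snd)
  exact (h1.comp h2).clm_apply h3

/-- Since ‖x‖ ≤ ‖(x, θ q x)‖, the decay of Ψ on the product gives decay in x uniformly in θ ∈ [0,
1], whatever q is. -/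
theorem exists_bound_comp_graphCLM (k n : ℕ) : ∃ C, ∀ θ ∈ Set.Icc (0 : ℝ) 1, ∀ x,
    ‖x‖ ^ k * ‖iteratedFDeriv ℝ n (Ψ ∘ graphCLM q θ) x‖ ≤ C := by
  obtain ⟨C, -, hC⟩ := Ψ.decay k n
  refine ⟨C * (1 + ‖q‖) ^ n, fun θ hθ x => ?_⟩
  have h1 : ‖graphCLM q θ‖ ≤ 1 + ‖q‖ := by
    refine ContinuousLinearMap.opNorm_le_bound _ (by positivity) fun y => ?_
    have h4 : ‖θ • q y‖ ≤ ‖q‖ * ‖y‖ := by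
      rw [norm_smul, Real.norm_eq_abs, abs_of_nonneg hθ.1]
      exact (mul_le_of_le_one_left (norm_nonneg _) hθ.2).trans (q.le_opNorm y)
    rw [graphCLM_apply, Prod.norm_def, add_mul, one_mul]
    exact max_le (le_add_of_nonneg_right (by positivity))
      (h4.trans (le_add_of_nonneg_left (norm_nonneg _)))
  have h2 : ‖x‖ ≤ ‖graphCLM q θ x‖ := by
    rw [graphCLM_apply, Prod.norm_def]; exact le_max_left _ _
  have h3 := hC (graphCLM q θ x)
  rw [iteratedFDeriv_comp_graphCLM]
  calc _ ≤ ‖graphCLM q θ x‖ ^ k * (‖iteratedFDeriv ℝ n Ψ (graphCLM q θ x)‖ *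
        ∏ _i : Fin n, ‖graphCLM q θ‖) := by
        gcongr
        exact ContinuousMultilinearMap.norm_compContinuousLinearMap_le _ _
    _ = (‖graphCLM q θ x‖ ^ k * ‖iteratedFDeriv ℝ n Ψ (graphCLM q θ x)‖) *
        ‖graphCLM q θ‖ ^ n := by simp [mul_assoc]
    _ ≤ C * (1 + ‖q‖) ^ n := by
        have : 0 ≤ C := le_trans (by positivity) h3
        gcongr

variable [CompleteSpace F]

/-- Differentiation under the integral, dominated by the bound uniform in θ. Packaging all orders as
one Taylor series identifies every derivative of the integral, so its decay can be read off at once.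
-/
theorem hasFTaylorSeriesUpTo_integral_graphCLM :
    HasFTaylorSeriesUpTo ((⊤ : ℕ∞) : WithTop ℕ∞)
      (fun x => ∫ θ in (0 : ℝ)..1, Ψ (x, θ • q x))
      (fun x n => ∫ θ in (0 : ℝ)..1, iteratedFDeriv ℝ n (Ψ ∘ graphCLM q θ) x) := by
  have hc (n : ℕ) (x : V) : Continuous fun θ : ℝ => iteratedFDeriv ℝ n (Ψ ∘ graphCLM q θ) x :=
    (continuous_iteratedFDeriv_comp_graphCLM q Ψ n).comp (by fun_prop : Continuous fun θ : ℝ => (θ, x))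
  have hd (n : ℕ) (x : V) : HasFDerivAt
      (fun x => ∫ θ in (0 : ℝ)..1, iteratedFDeriv ℝ n (Ψ ∘ graphCLM q θ) x)
      (∫ θ in (0 : ℝ)..1, (iteratedFDeriv ℝ (n + 1) (Ψ ∘ graphCLM q θ) x).curryLeft) x := by
    obtain ⟨C, hC⟩ := exists_bound_comp_graphCLM q Ψ 0 (n + 1)
    refine intervalIntegral.hasFDerivAt_integral_of_dominated_of_fderiv_le (bound := fun _ => C)
      (F' := fun x θ => (iteratedFDeriv ℝ (n + 1) (Ψ ∘ graphCLM q θ) x).curryLeft)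
      Filter.univ_mem ?_ ?_ ?_ ?_ (by simp) ?_
    · exact Filter.Eventually.of_forall fun y => (hc n y).aestronglyMeasurable
    · exact (hc n x).intervalIntegrable _ _
    · exact ((continuousMultilinearCurryLeftEquiv ℝ (fun _ : Fin (n + 1) => V)
        F).continuous.comp (hc (n + 1) x)).aestronglyMeasurable
    · refine Filter.Eventually.of_forall fun θ hθ y _ => ?_
      rw [Set.uIoc_of_le zero_le_one] at hθ
      rw [ContinuousMultilinearMap.curryLeft_norm]
      simpa using hC θ ⟨hθ.1.le, hθ.2⟩ y
    · refine Filter.Eventually.of_forall fun θ _ y _ => ?_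
      exact ((contDiff_comp_graphCLM q Ψ θ).ftaylorSeries).fderiv n
        (by exact_mod_cast ENat.natCast_lt_top n) y
  have hcurry (n : ℕ) (x : V) :
      ∫ θ in (0 : ℝ)..1, (iteratedFDeriv ℝ (n + 1) (Ψ ∘ graphCLM q θ) x).curryLeft =
      (∫ θ in (0 : ℝ)..1, iteratedFDeriv ℝ (n + 1) (Ψ ∘ graphCLM q θ) x).curryLeft := by
    let L : (V [×(n + 1)]→L[ℝ] F) →L[ℝ] (V →L[ℝ] V [×n]→L[ℝ] F) :=
      (continuousMultilinearCurryLeftEquiv ℝ (fun _ : Fin (n + 1) => V)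
        F).toContinuousLinearEquiv.toContinuousLinearMap
    have h := ContinuousLinearMap.intervalIntegral_comp_comm (𝕜 := ℝ)
      (E := V [×(n + 1)]→L[ℝ] F) (F := V →L[ℝ] V [×n]→L[ℝ] F) L
      ((hc (n + 1) x).intervalIntegrable 0 1 (μ := volume))
    exact h
  refine ⟨fun x => ?_, fun n _ x => ?_, fun n _ => ?_⟩
  · have h := ContinuousLinearMap.intervalIntegral_comp_comm
      (continuousMultilinearCurryFin0 ℝ V F).toContinuousLinearEquiv.toContinuousLinearMap
      ((hc 0 x).intervalIntegrable 0 1 (μ := volume))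
    exact h.symm
  · have := hd n x
    rwa [hcurry] at this
  · exact continuous_iff_continuousAt.2 fun x => (hd n x).continuousAt

theorem exists_schwartz_integral_graphCLM :
    ∃ G : 𝓢(V, F), ∀ x, G x = ∫ θ in (0 : ℝ)..1, Ψ (x, θ • q x) := by
  have hT := hasFTaylorSeriesUpTo_integral_graphCLM q Ψ
  refine ⟨⟨fun x => ∫ θ in (0 : ℝ)..1, Ψ (x, θ • q x), hT.contDiff, fun k n => ?_⟩, fun x => rfl⟩
  obtain ⟨C, hC⟩ := exists_bound_comp_graphCLM q Ψ k n
  refine ⟨C, fun x => ?_⟩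
  rw [← hT.eq_iteratedFDeriv (by exact_mod_cast le_top) x]
  have : ‖‖x‖ ^ k • ∫ θ in (0 : ℝ)..1, iteratedFDeriv ℝ n (Ψ ∘ graphCLM q θ) x‖ ≤
      C * |(1 : ℝ) - 0| := by
    rw [← intervalIntegral.integral_smul]
    refine intervalIntegral.norm_integral_le_of_norm_le_const fun θ hθ => ?_
    rw [Set.uIoc_of_le zero_le_one] at hθ
    rw [norm_smul, norm_pow, norm_norm]
    exact hC θ ⟨hθ.1.le, hθ.2⟩ x
  rw [norm_smul, norm_pow, norm_norm] at this
  simpa using this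

end ParametricIntegral

/-- **Hadamard's lemma** for Schwartz functions: a Schwartz function that vanishes on the image
of the projection `x ↦ x - ∑ ξ_i(x) e_i` is a combination of the `ξ_i` with Schwartz
coefficients. -/
theorem exists_eq_sum_smul [FiniteDimensional ℝ V] [CompleteSpace F] {ι : Type*} [Fintype ι]
    (ξ : ι → V →L[ℝ] ℝ) (e : ι → V) (g : 𝓢(V, F)) (hg : ∀ x, g (x - ∑ i, ξ i x • e i) = 0) :
    ∃ G : ι → 𝓢(V, F), ∀ x, g x = ∑ i, ξ i x • G i x := by
  obtain ⟨m, hm⟩ := exists_schwartz_one (V := V)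
  let q : V →L[ℝ] V := ∑ i, (ξ i).smulRight (e i)
  have hq (x : V) : q x = ∑ i, ξ i x • e i := by simp [q]
  -- The usual integrand, a derivative of g(x - θ q x), need not decay along the kernel of x ↦ x - q
  -- x when θ reaches 1. The cutoff in Φ(x, v) = m(v) g(x - v) restores decay: Φ is Schwartz on the
  -- product, Φ(x, 0) = g(x) and Φ(x, q x) = 0. Integrating d/dθ Φ(x, θ q x) from 0 to 1 gives
  -- -g(x).
  let s : (V × V) ≃L[ℝ] (V × V) := ContinuousLinearEquiv.equivOfInverse
    ((ContinuousLinearMap.fst ℝ V V - ContinuousLinearMap.snd ℝ V V).prod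
      (ContinuousLinearMap.snd ℝ V V))
    ((ContinuousLinearMap.fst ℝ V V + ContinuousLinearMap.snd ℝ V V).prod
      (ContinuousLinearMap.snd ℝ V V)) (fun x => by simp) (fun x => by simp)
  let Φ : 𝓢(V × V, F) := SchwartzMap.compCLMOfContinuousLinearEquiv ℝ s (tensor g m)
  have hΦ (x v : V) : Φ (x, v) = m v • g (x - v) := rfl
  choose G hG using fun i => exists_schwartz_integral_graphCLM q (∂_{((0, e i) : V × V)} Φ)
  refine ⟨fun i => -G i, fun x => ?_⟩
  have hder (θ : ℝ) : HasDerivAt (fun θ : ℝ => Φ (x, θ • q x))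
      (∑ i, ξ i x • (∂_{((0, e i) : V × V)} Φ) (x, θ • q x)) θ := by
    have h1 : HasDerivAt (fun θ : ℝ => ((x, θ • q x) : V × V)) (0, q x) θ := by
      have := (hasDerivAt_id θ).smul_const (q x)
      rw [one_smul] at this
      exact (hasDerivAt_const θ x).prodMk this
    have h2 := (Φ.hasFDerivAt (x, θ • q x)).comp_hasDerivAt θ h1
    refine h2.congr_deriv ?_
    have h3 : ((0, q x) : V × V) = ∑ i, ξ i x • ((0, e i) : V × V) := by
      ext <;> simp [hq, Prod.fst_sum, Prod.snd_sum]
    rw [h3, map_sum]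
    exact Finset.sum_congr rfl fun i _ => by
      rw [map_smul, SchwartzMap.lineDerivOp_apply_eq_fderiv]
  have hcont (i : ι) : Continuous fun θ : ℝ => (∂_{((0, e i) : V × V)} Φ) (x, θ • q x) :=
    (SchwartzMap.continuous _).comp (by fun_prop)
  have hI := intervalIntegral.integral_eq_sub_of_hasDerivAt (a := 0) (b := 1) (fun θ _ => hder θ)
    ((continuous_finsetSum _ fun i _ => (hcont i).const_smul _).intervalIntegrable _ _)
  have hsum : (∫ θ in (0 : ℝ)..1, ∑ i, ξ i x • (∂_{((0, e i) : V × V)} Φ) (x, θ • q x)) =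
      ∑ i, ∫ θ in (0 : ℝ)..1, ξ i x • (∂_{((0, e i) : V × V)} Φ) (x, θ • q x) :=
    intervalIntegral.integral_finsetSum
      fun i _ => ((hcont i).const_smul _).intervalIntegrable _ _
  rw [hsum] at hI
  simp only [intervalIntegral.integral_smul, ← hG, hΦ, one_smul, zero_smul, sub_zero, hm] at hI
  rw [hq, hg, smul_zero, zero_sub] at hI
  simp [hI]

section Fourier

variable {ι : Type*} [Fintype ι] [DecidableEq ι]

/-- The Fourier transform of g vanishes at 0, so Hadamard's lemma at the origin writes it as ∑ x_i
G_i. The inverse transform turns multiplication by x_i into a derivative, up to the constant 2πi. -/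
theorem exists_eq_sum_lineDeriv_complex (g : 𝓢(EuclideanSpace ℝ ι, ℂ)) (hg : ∫ x, g x = 0) :
    ∃ G : ι → 𝓢(EuclideanSpace ℝ ι, ℂ), g = ∑ i, ∂_{EuclideanSpace.single i (1 : ℝ)} (G i) := by
  have h0 : (𝓕 g) 0 = 0 := by
    rw [SchwartzMap.fourier_coe, Real.fourier_eq]
    simpa using hg
  obtain ⟨G, hG⟩ := exists_eq_sum_smul (fun i => EuclideanSpace.proj (𝕜 := ℝ) i)
    (fun i => EuclideanSpace.single i (1 : ℝ)) (𝓕 g) (fun x => by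
      have : (∑ i, x i • EuclideanSpace.single i (1 : ℝ) : EuclideanSpace ℝ ι) = x := by
        ext j; simp [Finset.sum_apply, Pi.single_apply]
      change (𝓕 g) (x - ∑ i, x i • EuclideanSpace.single i (1 : ℝ)) = 0
      rw [this, sub_self, h0])
  have hne : (2 * Real.pi * Complex.I : ℂ) ≠ 0 := by simp [Real.pi_ne_zero]
  refine ⟨fun i => 𝓕⁻ ((2 * Real.pi * Complex.I : ℂ)⁻¹ • G i), ?_⟩
  have h1 : 𝓕 g = ∑ i, SchwartzMap.smulLeftCLM ℂ
      (fun x : EuclideanSpace ℝ ι => inner ℝ x (EuclideanSpace.single i (1 : ℝ))) (G i) := by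
    ext x
    rw [hG, sum_apply]
    refine Finset.sum_congr rfl fun i _ => ?_
    rw [SchwartzMap.smulLeftCLM_apply_apply (by fun_prop)]
    simp [EuclideanSpace.inner_single_right]
  have h2 : g = 𝓕⁻ (𝓕 g) := by simp
  rw [h2, h1, ← FourierTransform.fourierInvCLM_apply (R := ℂ), map_sum]
  refine Finset.sum_congr rfl fun i _ => ?_
  rw [SchwartzMap.lineDerivOp_fourierInv_eq, FourierTransform.fourierInvCLM_apply]
  congr 1
  ext x
  rw [smul_apply, SchwartzMap.smulLeftCLM_apply_apply (by fun_prop),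
    SchwartzMap.smulLeftCLM_apply_apply (by fun_prop), smul_apply, smul_comm, smul_inv_smul₀ hne]

variable {𝕜 : Type*} [RCLike 𝕜]

theorem exists_eq_sum_lineDeriv (g : 𝓢(EuclideanSpace ℝ ι, 𝕜)) (hg : ∫ x, g x = 0) :
    ∃ G : ι → 𝓢(EuclideanSpace ℝ ι, 𝕜), g = ∑ i, ∂_{EuclideanSpace.single i (1 : ℝ)} (G i) := by
  -- A real-linear embedding of 𝕜 in ℂ and a retraction of it treat both scalar fields at once and
  -- reduce to the complex case.
  let j : 𝕜 →L[ℝ] ℂ := Complex.ofRealCLM.comp RCLike.reCLM +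
    ((RCLike.imCLM : 𝕜 →L[ℝ] ℝ).smulRight Complex.I)
  let ρ : ℂ →L[ℝ] 𝕜 := RCLike.ofRealCLM.comp Complex.reCLM +
    (Complex.imCLM : ℂ →L[ℝ] ℝ).smulRight (RCLike.I : 𝕜)
  have hρj (z : 𝕜) : ρ (j z) = z := by
    have := RCLike.re_add_im z
    simp [ρ, j, RCLike.real_smul_eq_coe_mul, this]
  obtain ⟨G, hG⟩ := exists_eq_sum_lineDeriv_complex (g.postcompCLM j) (by
    have := j.integral_comp_comm (g.integrable (μ := volume))
    rw [hg, map_zero] at this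
    exact this)
  refine ⟨fun i => (G i).postcompCLM ρ, ?_⟩
  ext x
  have h := congrArg (fun f : 𝓢(EuclideanSpace ℝ ι, ℂ) => ρ (f x)) hG
  simp only [SchwartzMap.postcompCLM_apply, hρj, sum_apply, map_sum] at h
  rw [h, sum_apply]
  refine Finset.sum_congr rfl fun i _ => ?_
  rw [SchwartzMap.lineDerivOp_apply_eq_fderiv, SchwartzMap.lineDerivOp_apply_eq_fderiv]
  have := (ρ.hasFDerivAt.comp x ((G i).hasFDerivAt x)).fderiv
  change _ = fderiv ℝ (ρ ∘ G i) x _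
  rw [this]
  rfl

end Fourier

end Schwartz

/-! ### One-dimensional parameter domains. -/

/-- The domain of integration of one parameter of a multivariate spline: a half-line, the full
line, or a point. -/
inductive Mode
  | pos | neg | line | zero

namespace Mode

/-- The domain of a mode. -/
def cone : Mode → Set ℝ
  | pos => Set.Ici 0
  | neg => Set.Iic 0
  | line => Set.univ
  | zero => {0}

/-- The measure attached to a mode. -/
def measure : Mode → Measure ℝ
  | pos => volume.restrict (Set.Ici 0)
  | neg => volume.restrict (Set.Iic 0)
  | line => volume
  | zero => Measure.dirac 0

/-- The sign attached to a mode. -/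
def weight (𝕜 : Type*) [RCLike 𝕜] : Mode → 𝕜
  | neg => -1
  | _ => 1

instance (c : Mode) : SigmaFinite c.measure := by
  cases c <;> simp only [measure] <;> infer_instance

theorem ae_mem_cone (c : Mode) : ∀ᵐ s ∂c.measure, s ∈ c.cone := by
  cases c
  · exact ae_restrict_mem measurableSet_Ici
  · exact ae_restrict_mem measurableSet_Iic
  · exact Filter.Eventually.of_forall fun _ => Set.mem_univ _
  · simp [measure, cone, ae_dirac_eq]

theorem zero_mem_cone (c : Mode) : (0 : ℝ) ∈ c.cone := by
  cases c <;> simp [cone]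

theorem smul_mem_cone (c : Mode) {r s : ℝ} (hr : 0 ≤ r) (hs : s ∈ c.cone) : r * s ∈ c.cone := by
  cases c <;> simp only [cone, Set.mem_Ici, Set.mem_Iic, Set.mem_univ, Set.mem_singleton_iff] at *
  · positivity
  · exact mul_nonpos_of_nonneg_of_nonpos hr hs
  · simp [hs]

theorem isClosed_cone (c : Mode) : IsClosed c.cone := by
  cases c
  · exact isClosed_Ici
  · exact isClosed_Iic
  · exact isClosed_univ
  · exact isClosed_singleton

theorem integrable_majorant (c : Mode) :
    Integrable (fun s : ℝ => (1 + ‖s‖) ^ (-2 : ℝ)) c.measure := by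
  have h : Integrable (fun s : ℝ => (1 + ‖s‖) ^ (-2 : ℝ)) :=
    integrable_one_add_norm (by simp)
  cases c
  · exact h.integrableOn
  · exact h.integrableOn
  · exact h
  · exact integrable_dirac (by simp)

variable {𝕜 : Type*} [RCLike 𝕜]

theorem integral_deriv_Ici (ψ : 𝓢(ℝ, 𝕜)) : ∫ s in Set.Ici 0, deriv ψ s = -ψ 0 := by
  have hint : Integrable (deriv ψ) :=
    (SchwartzMap.derivCLM 𝕜 𝕜 ψ).integrable (μ := volume)
  rw [integral_Ici_eq_integral_Ioi, integral_Ioi_of_hasDerivAt_of_tendsto'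
    (fun x _ => ψ.hasDerivAt x) hint.integrableOn
    (ψ.tendsto_cocompact.mono_left atTop_le_cocompact), zero_sub]

theorem integral_deriv_Iic (ψ : 𝓢(ℝ, 𝕜)) : ∫ s in Set.Iic 0, deriv ψ s = ψ 0 := by
  have hint : Integrable (deriv ψ) :=
    (SchwartzMap.derivCLM 𝕜 𝕜 ψ).integrable (μ := volume)
  rw [integral_Iic_of_hasDerivAt_of_tendsto'
    (fun x _ => ψ.hasDerivAt x) hint.integrableOn
    (ψ.tendsto_cocompact.mono_left atBot_le_cocompact), sub_zero]

theorem integral_deriv_line (ψ : 𝓢(ℝ, 𝕜)) : ∫ s, deriv ψ s = 0 := by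
  have hint : Integrable (deriv ψ) :=
    (SchwartzMap.derivCLM 𝕜 𝕜 ψ).integrable (μ := volume)
  rw [integral_of_hasDerivAt_of_tendsto (fun x => ψ.hasDerivAt x) hint
    (ψ.tendsto_cocompact.mono_left atBot_le_cocompact)
    (ψ.tendsto_cocompact.mono_left atTop_le_cocompact), sub_zero]

/-- The weight -1 on the negative half-line is chosen so that both signed half-lines are primitives
of the same δ₀. Their difference is then the full line, as `weight_mul_integral_sub` records. -/
theorem weight_mul_integral_neg_deriv (c : Mode) (hc : c = pos ∨ c = neg) (ψ : 𝓢(ℝ, 𝕜)) :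
    weight 𝕜 c * ∫ s, -deriv ψ s ∂c.measure = weight 𝕜 zero * ∫ s, ψ s ∂zero.measure := by
  rw [integral_neg]
  rcases hc with rfl | rfl
  · simp only [weight, measure, integral_deriv_Ici, integral_dirac, neg_neg]
  · simp only [weight, measure, integral_deriv_Iic, integral_dirac]
    ring

theorem weight_mul_integral_sub (ψ : 𝓢(ℝ, 𝕜)) :
    weight 𝕜 pos * ∫ s, ψ s ∂pos.measure - weight 𝕜 neg * ∫ s, ψ s ∂neg.measure =
      weight 𝕜 line * ∫ s, ψ s ∂line.measure := by
  simp only [weight, measure, one_mul, neg_one_mul, sub_neg_eq_add]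
  rw [integral_Ici_eq_integral_Ioi, add_comm]
  exact intervalIntegral.integral_Iic_add_Ioi ψ.integrable.integrableOn ψ.integrable.integrableOn

end Mode

section Line

variable {𝕜 : Type*} [RCLike 𝕜] {V : Type*} [NormedAddCommGroup V] [NormedSpace ℝ V]

theorem exists_schwartz_line (g : 𝓢(V, 𝕜)) {a : V} (ha : a ≠ 0) (v : V) :
    ∃ ψ : 𝓢(ℝ, 𝕜), ∀ s, ψ s = g (s • a + v) ∧ deriv ψ s = (∂_{a} g) (s • a + v) := by
  have ha' : 0 < ‖a‖ := norm_pos_iff.2 ha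
  have h1 : Function.HasTemperateGrowth fun s : ℝ => s • a + v := by
    have := ((ContinuousLinearMap.id ℝ ℝ).smulRight a).hasTemperateGrowth
    exact this.add (Function.HasTemperateGrowth.const v)
  have h2 : AntilipschitzWith ‖a‖₊⁻¹ fun s : ℝ => s • a + v := by
    refine AntilipschitzWith.of_le_mul_dist fun x y => ?_
    rw [dist_add_right, dist_eq_norm (x • a), ← sub_smul, norm_smul, NNReal.coe_inv, coe_nnnorm,
      Real.dist_eq, Real.norm_eq_abs]
    field_simp
    exact le_rfl
  refine ⟨SchwartzMap.compCLMOfAntilipschitz ℝ h1 h2 g, fun s => ⟨rfl, ?_⟩⟩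
  have h3 : HasDerivAt (fun s : ℝ => s • a + v) a s := by
    simpa using ((hasDerivAt_id s).smul_const a).add_const v
  exact ((g.hasFDerivAt _).comp_hasDerivAt s h3).deriv

end Line

/-! ### Splines with mixed modes: convergence and derivatives. -/

section Spline

variable (𝕜 : Type*) [RCLike 𝕜] {V : Type*} [NormedAddCommGroup V] [NormedSpace ℝ V] {m : ℕ}

/-- The parameter cone of a list of modes. -/
def paramCone (σ : Fin m → Mode) : Set (Fin m → ℝ) := {t | ∀ i, t i ∈ (σ i).cone}

/-- The parameter measure of a list of modes. -/
def paramMeasure (σ : Fin m → Mode) : Measure (Fin m → ℝ) := Measure.pi fun i => (σ i).measure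

/-- The list of modes `σ` is admissible for `X` if `t ↦ ∑ t_i X_i` is proper on its cone. -/
def Admissible (X : Fin m → V) (σ : Fin m → Mode) : Prop :=
  ∀ t ∈ paramCone σ, ∑ i, t i • X i = 0 → t = 0

variable {X : Fin m → V} {σ τ : Fin m → Mode}

theorem Admissible.mono (h : Admissible X σ) (hτ : ∀ i, (τ i).cone ⊆ (σ i).cone) :
    Admissible X τ := fun t ht => h t fun i => hτ i (ht i)

/-- The cone is closed and stable under positive dilations. Hence ‖∑ t_i X_i‖ attains a positive
minimum d on its unit sphere, and homogeneity yields ‖t‖ ≤ d⁻¹ ‖∑ t_i X_i‖. -/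
theorem Admissible.exists_bound (h : Admissible X σ) :
    ∃ c : ℝ, 1 ≤ c ∧ ∀ t ∈ paramCone σ, 1 + ‖t‖ ≤ c * (1 + ‖∑ i, t i • X i‖) := by
  have hcl : IsClosed (paramCone σ) := by
    have : paramCone σ = ⋂ i, (fun t : Fin m → ℝ => t i) ⁻¹' (σ i).cone := by
      ext t; simp [paramCone]
    rw [this]
    exact isClosed_iInter fun i => (σ i).isClosed_cone.preimage (continuous_apply i)
  have hK : IsCompact (paramCone σ ∩ Metric.sphere 0 1) := (isCompact_sphere _ _).inter_left hcl
  have hcont : Continuous fun t : Fin m → ℝ => ‖∑ i, t i • X i‖ := by fun_prop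
  obtain ⟨d, hd, hdb⟩ : ∃ d : ℝ, 0 < d ∧
      ∀ t ∈ paramCone σ ∩ Metric.sphere 0 1, d ≤ ‖∑ i, t i • X i‖ := by
    rcases (paramCone σ ∩ Metric.sphere (0 : Fin m → ℝ) 1).eq_empty_or_nonempty with he | hne
    · exact ⟨1, one_pos, by simp [he]⟩
    · obtain ⟨t₀, ht₀, hmin⟩ := hK.exists_isMinOn hne hcont.continuousOn
      refine ⟨_, norm_pos_iff.2 fun h0 => ?_, fun t ht => hmin ht⟩
      have := ht₀.2
      rw [h t₀ ht₀.1 h0] at this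
      simp at this
  refine ⟨1 + d⁻¹, by simpa using hd.le, fun t ht => ?_⟩
  have key : ‖t‖ ≤ d⁻¹ * ‖∑ i, t i • X i‖ := by
    rcases eq_or_ne t 0 with rfl | ht0
    · simp
    have hpos : 0 < ‖t‖ := norm_pos_iff.2 ht0
    have h1 := hdb (‖t‖⁻¹ • t) ⟨fun i => by
      simpa using (σ i).smul_mem_cone (inv_nonneg.2 hpos.le) (ht i), by
      simp [norm_smul, hpos.ne']⟩
    have h2 : ∑ i, (‖t‖⁻¹ • t) i • X i = ‖t‖⁻¹ • ∑ i, t i • X i := by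
      simp [Finset.smul_sum, mul_smul]
    rw [h2, norm_smul, norm_inv, norm_norm] at h1
    field_simp at h1 ⊢
    linarith
  have : 0 ≤ d⁻¹ := inv_nonneg.2 hd.le
  nlinarith [norm_nonneg (∑ i, t i • X i)]

theorem ae_mem_paramCone (σ : Fin m → Mode) : ∀ᵐ t ∂paramMeasure σ, t ∈ paramCone σ :=
  ae_all_iff.2 fun i => (Measure.tendsto_eval_ae_ae (i := i)).eventually (σ i).ae_mem_cone

theorem integrable_prod_majorant (σ : Fin m → Mode) :
    Integrable (fun t : Fin m → ℝ => ∏ i, (1 + ‖t i‖) ^ (-2 : ℝ)) (paramMeasure σ) :=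
  Integrable.fintype_prod fun i => (σ i).integrable_majorant

theorem Admissible.exists_norm_le (h : Admissible X σ) :
    ∃ C : ℝ, 0 ≤ C ∧ ∀ f : 𝓢(V, 𝕜), ∀ t ∈ paramCone σ, ‖f (∑ i, t i • X i)‖ ≤
      (∏ i, (1 + ‖t i‖) ^ (-2 : ℝ)) *
        (C * (Finset.Iic (2 * m, 0)).sup (schwartzSeminormFamily 𝕜 V 𝕜) f) := by
  obtain ⟨c, hc, hb⟩ := h.exists_bound
  refine ⟨c ^ (2 * m) * 2 ^ (2 * m), by positivity, fun f t ht => ?_⟩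
  have h1 := SchwartzMap.one_add_le_sup_seminorm_apply (𝕜 := 𝕜) (m := (2 * m, 0)) (k := 2 * m)
    (n := 0) le_rfl le_rfl f (∑ i, t i • X i)
  rw [norm_iteratedFDeriv_zero] at h1
  -- A product majorant is integrable for every mode, including Dirac masses. Each coordinate costs
  -- the exponent 2, which explains the seminorms of order 2m.
  have h2 : ∏ i, (1 + ‖t i‖) ^ (-2 : ℝ) = (∏ i, (1 + ‖t i‖) ^ 2)⁻¹ := by
    rw [← Finset.prod_inv_distrib]
    refine Finset.prod_congr rfl fun i _ => ?_
    rw [Real.rpow_neg (by positivity)]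
    norm_num
  have h3 : ∏ i, (1 + ‖t i‖) ^ 2 ≤ (1 + ‖t‖) ^ (2 * m) := by
    calc _ ≤ ∏ _i : Fin m, (1 + ‖t‖) ^ 2 := by
          gcongr with i
          exact norm_le_pi_norm t i
      _ = _ := by simp [← pow_mul]
  rw [h2, ← div_eq_inv_mul, le_div_iff₀' (Finset.prod_pos fun i _ => by positivity)]
  calc (∏ i, (1 + ‖t i‖) ^ 2) * ‖f (∑ i, t i • X i)‖
      ≤ (c * (1 + ‖∑ i, t i • X i‖)) ^ (2 * m) * ‖f (∑ i, t i • X i)‖ := by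
        gcongr
        refine h3.trans ?_
        gcongr
        exact hb t ht
    _ = c ^ (2 * m) * ((1 + ‖∑ i, t i • X i‖) ^ (2 * m) * ‖f (∑ i, t i • X i)‖) := by
        rw [mul_pow, mul_assoc]
    _ ≤ c ^ (2 * m) * (2 ^ (2 * m) * (Finset.Iic (2 * m, 0)).sup
          (schwartzSeminormFamily 𝕜 V 𝕜) f) := by
        exact mul_le_mul_of_nonneg_left h1 (by positivity)
    _ = _ := by ring

theorem Admissible.integrable (h : Admissible X σ) (f : 𝓢(V, 𝕜)) :
    Integrable (fun t : Fin m → ℝ => f (∑ i, t i • X i)) (paramMeasure σ) := by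
  obtain ⟨C, -, hC⟩ := h.exists_norm_le 𝕜
  refine Integrable.mono' ((integrable_prod_majorant σ).mul_const _) ?_
    ((ae_mem_paramCone σ).mono (hC f))
  have : Continuous fun t : Fin m → ℝ => f (∑ i, t i • X i) := f.continuous.comp (by fun_prop)
  exact this.aestronglyMeasurable

variable (X σ)

open scoped Classical in
/-- The signed multivariate spline with parameter domains prescribed by a list of modes. -/
def modeSpline : TempDist 𝕜 V :=
  if h : Admissible X σ then
    (∏ i, (σ i).weight 𝕜) • ContinuousLinearMap.toPointwiseConvergenceCLM 𝕜 _ _ _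
      (SchwartzMap.mkCLMtoNormedSpace (𝕜 := 𝕜) (𝕜' := 𝕜) (σ := RingHom.id 𝕜)
        (fun f : 𝓢(V, 𝕜) => ∫ t, f (∑ i, t i • X i) ∂paramMeasure σ)
        (fun f g => integral_add (h.integrable 𝕜 f) (h.integrable 𝕜 g))
        (fun c f => integral_const_mul c _)
        (by
          obtain ⟨C, hC0, hC⟩ := h.exists_norm_le 𝕜
          refine ⟨Finset.Iic (2 * m, 0),
            (∫ t, ∏ i, (1 + ‖t i‖) ^ (-2 : ℝ) ∂paramMeasure σ) * C, ?_, fun f => ?_⟩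
          · exact mul_nonneg (integral_nonneg fun t => Finset.prod_nonneg fun i _ => by positivity)
              hC0
          · rw [mul_assoc, ← integral_mul_const]
            exact norm_integral_le_of_norm_le ((integrable_prod_majorant σ).mul_const _)
              ((ae_mem_paramCone σ).mono (hC f))))
  -- The default value makes the spline total, so that modes can be updated without carrying a proof
  -- of convergence.
  else 0

variable {X σ 𝕜}

theorem Admissible.modeSpline_apply (h : Admissible X σ) (f : 𝓢(V, 𝕜)) :
    modeSpline 𝕜 X σ f =
      (∏ i, (σ i).weight 𝕜) * ∫ t, f (∑ i, t i • X i) ∂paramMeasure σ := by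
  rw [modeSpline, dif_pos h]
  rfl

theorem integral_paramMeasure_succAbove {n : ℕ} (σ : Fin (n + 1) → Mode) (i : Fin (n + 1))
    {F : (Fin (n + 1) → ℝ) → 𝕜} (hF : Integrable F (paramMeasure σ)) :
    ∫ t, F t ∂paramMeasure σ = ∫ t', ∫ s, F (i.insertNth s t') ∂(σ i).measure
      ∂paramMeasure (σ ∘ i.succAbove) := by
  have hmp := measurePreserving_piFinSuccAbove (fun i => (σ i).measure) i
  have hmp' := hmp.symm
  have h1 := hmp'.integral_comp (MeasurableEquiv.measurableEmbedding _) F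
  have h2 := (hmp'.integrable_comp_emb (MeasurableEquiv.measurableEmbedding _)).2 hF
  rw [paramMeasure, ← h1]
  exact integral_prod_symm _ h2

/-- Fubini isolates the i-th parameter together with its weight, so that identities between modes
reduce to one-variable calculus. -/
theorem Admissible.modeSpline_apply_succAbove {n : ℕ} {X : Fin (n + 1) → V}
    {σ : Fin (n + 1) → Mode} (h : Admissible X σ) (i : Fin (n + 1)) (f : 𝓢(V, 𝕜)) :
    modeSpline 𝕜 X σ f = (∏ j, (σ (i.succAbove j)).weight 𝕜) *
      ∫ t', (σ i).weight 𝕜 * ∫ s, f (s • X i + ∑ j, t' j • X (i.succAbove j)) ∂(σ i).measure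
        ∂paramMeasure (σ ∘ i.succAbove) := by
  rw [h.modeSpline_apply, integral_paramMeasure_succAbove σ i (h.integrable 𝕜 f),
    integral_const_mul, Fin.prod_univ_succAbove _ i]
  simp only [Fin.sum_univ_succAbove _ i, Fin.insertNth_apply_same, Fin.insertNth_apply_succAbove]
  ring

theorem cone_update_zero_subset (σ : Fin m → Mode) (i j : Fin m) :
    (Function.update σ i Mode.zero j).cone ⊆ (σ j).cone := by
  rcases eq_or_ne j i with rfl | hj
  · simpa [Mode.cone] using Mode.zero_mem_cone _
  · simp [hj]

theorem cone_update_subset_of_line {i : Fin m} (hi : σ i = Mode.line) (c : Mode) (j : Fin m) :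
    (Function.update σ i c j).cone ⊆ (σ j).cone := by
  rcases eq_or_ne j i with rfl | hj
  · simp [hi, Mode.cone]
  · simp [hj]

theorem Admissible.distDeriv_modeSpline (h : Admissible X σ) {i : Fin m} (hX : X i ≠ 0)
    (hi : σ i = Mode.pos ∨ σ i = Mode.neg) :
    distDeriv 𝕜 (X i) (modeSpline 𝕜 X σ) = modeSpline 𝕜 X (Function.update σ i Mode.zero) := by
  obtain _ | n := m
  · exact i.elim0
  have h' : Admissible X (Function.update σ i Mode.zero) := h.mono (cone_update_zero_subset σ i)
  ext f
  rw [distDeriv_apply, h.modeSpline_apply_succAbove i, h'.modeSpline_apply_succAbove i]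
  have e1 : Function.update σ i Mode.zero ∘ i.succAbove = σ ∘ i.succAbove := by
    ext j; simp
  simp only [e1, Function.update_self, ne_eq, Fin.succAbove_ne, not_false_eq_true,
    Function.update_of_ne]
  congr 2
  ext t'
  obtain ⟨ψ, hψ⟩ := exists_schwartz_line f hX (∑ j, t' j • X (i.succAbove j))
  have := Mode.weight_mul_integral_neg_deriv (σ i) hi ψ
  simpa only [neg_apply, ← (hψ _).1, ← (hψ _).2] using this

theorem Admissible.distDeriv_modeSpline_line (h : Admissible X σ) {i : Fin m} (hX : X i ≠ 0)
    (hi : σ i = Mode.line) : distDeriv 𝕜 (X i) (modeSpline 𝕜 X σ) = 0 := by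
  obtain _ | n := m
  · exact i.elim0
  ext f
  rw [distDeriv_apply, h.modeSpline_apply_succAbove i]
  have : ∀ t' : Fin n → ℝ, ∫ s, (-∂_{X i} f) (s • X i + ∑ j, t' j • X (i.succAbove j))
      ∂(σ i).measure = 0 := fun t' => by
    obtain ⟨ψ, hψ⟩ := exists_schwartz_line f hX (∑ j, t' j • X (i.succAbove j))
    simp only [neg_apply, ← (hψ _).2, hi, Mode.measure, integral_neg, Mode.integral_deriv_line,
      neg_zero]
  simp only [this, mul_zero, integral_zero]
  rfl

theorem Admissible.modeSpline_sub (h : Admissible X σ) {i : Fin m} (hX : X i ≠ 0)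
    (hi : σ i = Mode.line) :
    modeSpline 𝕜 X (Function.update σ i Mode.pos) - modeSpline 𝕜 X (Function.update σ i Mode.neg) =
      modeSpline 𝕜 X σ := by
  obtain _ | n := m
  · exact i.elim0
  have h' (c : Mode) : Admissible X (Function.update σ i c) :=
    h.mono (cone_update_subset_of_line hi c)
  ext f
  rw [sub_apply, h.modeSpline_apply_succAbove i, (h' _).modeSpline_apply_succAbove i,
    (h' _).modeSpline_apply_succAbove i]
  have e1 (c : Mode) : Function.update σ i c ∘ i.succAbove = σ ∘ i.succAbove := by
    ext j; simp
  simp only [e1, Function.update_self, ne_eq, Fin.succAbove_ne, not_false_eq_true,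
    Function.update_of_ne]
  have hint (c : Mode) : Integrable (fun t' => c.weight 𝕜 *
      ∫ s, f (s • X i + ∑ j, t' j • X (i.succAbove j)) ∂c.measure)
      (paramMeasure (σ ∘ i.succAbove)) := by
    refine Integrable.const_mul ?_ _
    have h1 := (h' c).integrable 𝕜 f
    have hmp := (measurePreserving_piFinSuccAbove
      (fun j => (Function.update σ i c j).measure) i).symm
    have h2 := ((hmp.integrable_comp_emb (MeasurableEquiv.measurableEmbedding _)).2
      h1).integral_prod_right
    have e2 : (fun j => (Function.update σ i c (i.succAbove j)).measure) =
      fun j => ((σ ∘ i.succAbove) j).measure := by ext j; simp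
    simp only [Function.update_self] at h2
    rw [e2] at h2
    refine h2.congr (Filter.Eventually.of_forall fun t' => ?_)
    change ∫ s, f (∑ k, (i.insertNth s t' : Fin (n + 1) → ℝ) k • X k) ∂c.measure = _
    simp [Fin.sum_univ_succAbove _ i]
  rw [← mul_sub, ← integral_sub (hint _) (hint _), hi]
  congr 2
  ext t'
  obtain ⟨ψ, hψ⟩ := exists_schwartz_line f hX (∑ j, t' j • X (i.succAbove j))
  have := Mode.weight_mul_integral_sub ψ
  simpa only [← (hψ _).1] using this

end Spline

/-! ### The Weyl algebra action and Kashiwara's lemma. -/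

section Weyl

variable {𝕜 : Type*} [RCLike 𝕜] {V : Type*} [NormedAddCommGroup V] [NormedSpace ℝ V]

theorem hasTemperateGrowth_linear (ξ : V →L[ℝ] ℝ) :
    Function.HasTemperateGrowth fun x => (ξ x : 𝕜) :=
  ((RCLike.ofRealCLM (K := 𝕜)).comp ξ).hasTemperateGrowth

variable (𝕜)

/-- Multiplication of tempered distributions by a linear form. -/
def mulDist (ξ : V →L[ℝ] ℝ) : Module.End 𝕜 (TempDist 𝕜 V) :=
  (PointwiseConvergenceCLM.precomp 𝕜
    (SchwartzMap.smulLeftCLM 𝕜 fun x => (ξ x : 𝕜))).toLinearMap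

variable {𝕜}

theorem mulDist_apply (ξ : V →L[ℝ] ℝ) (T : TempDist 𝕜 V) (f : 𝓢(V, 𝕜)) :
    mulDist 𝕜 ξ T f = T (SchwartzMap.smulLeftCLM 𝕜 (fun x => (ξ x : 𝕜)) f) := rfl

theorem smulLeft_linear_apply (ξ : V →L[ℝ] ℝ) (f : 𝓢(V, 𝕜)) (x : V) :
    SchwartzMap.smulLeftCLM 𝕜 (fun x => (ξ x : 𝕜)) f x = ξ x * f x :=
  SchwartzMap.smulLeftCLM_apply_apply (hasTemperateGrowth_linear ξ) f x

theorem mulDist_comm (ξ η : V →L[ℝ] ℝ) :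
    mulDist 𝕜 ξ * mulDist 𝕜 η = mulDist 𝕜 η * mulDist 𝕜 ξ := by
  ext T f
  simp only [Module.End.mul_apply, mulDist_apply]
  congr 1
  ext x
  simp only [smulLeft_linear_apply]
  ring

theorem lineDeriv_smulLeft (ξ : V →L[ℝ] ℝ) (a : V) (f : 𝓢(V, 𝕜)) :
    ∂_{a} (SchwartzMap.smulLeftCLM 𝕜 (fun x => (ξ x : 𝕜)) f) =
      (ξ a : 𝕜) • f + SchwartzMap.smulLeftCLM 𝕜 (fun x => (ξ x : 𝕜)) (∂_{a} f) := by
  ext x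
  rw [add_apply, smul_apply, smulLeft_linear_apply, SchwartzMap.lineDerivOp_apply_eq_fderiv,
    SchwartzMap.lineDerivOp_apply_eq_fderiv]
  have h1 : HasFDerivAt (fun x => (ξ x : 𝕜)) ((RCLike.ofRealCLM (K := 𝕜)).comp ξ) x :=
    ((RCLike.ofRealCLM (K := 𝕜)).comp ξ).hasFDerivAt
  have h2 := h1.mul (f.hasFDerivAt x)
  have h3 : ⇑(SchwartzMap.smulLeftCLM 𝕜 (fun x => (ξ x : 𝕜)) f) = (fun x => (ξ x : 𝕜)) * f := by
    ext y
    exact smulLeft_linear_apply ξ f y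
  rw [h3, h2.fderiv]
  simp only [add_apply, smul_apply, ContinuousLinearMap.comp_apply, RCLike.ofRealCLM_apply,
    smul_eq_mul]
  ring

theorem distDeriv_mul_mulDist (ξ : V →L[ℝ] ℝ) (a : V) :
    distDeriv 𝕜 a * mulDist 𝕜 ξ = mulDist 𝕜 ξ * distDeriv 𝕜 a + (ξ a : 𝕜) • 1 := by
  ext T f
  simp only [Module.End.mul_apply, LinearMap.add_apply, LinearMap.smul_apply, Module.End.one_apply]
  change (mulDist 𝕜 ξ T) (-∂_{a} f) = mulDist 𝕜 ξ (distDeriv 𝕜 a T) f + (ξ a : 𝕜) • T f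
  rw [mulDist_apply, mulDist_apply, distDeriv_apply, lineDeriv_smulLeft]
  simp only [map_neg, map_add, map_smul]
  abel

theorem distDeriv_mul_mulDist_pow (ξ : V →L[ℝ] ℝ) (a : V) (n : ℕ) :
    distDeriv 𝕜 a * mulDist 𝕜 ξ ^ (n + 1) =
      mulDist 𝕜 ξ ^ (n + 1) * distDeriv 𝕜 a + ((n + 1) * (ξ a : 𝕜)) • mulDist 𝕜 ξ ^ n := by
  induction n with
  | zero => simp [distDeriv_mul_mulDist]
  | succ n ih =>
    rw [pow_succ, ← mul_assoc, ih, add_mul, mul_assoc, distDeriv_mul_mulDist, mul_add,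
      ← mul_assoc, smul_mul_assoc, ← pow_succ, ← pow_succ, mul_smul_comm, mul_one, add_assoc,
      ← add_smul]
    congr 2
    push_cast
    ring

theorem commute_distDeriv_mulDist {ξ : V →L[ℝ] ℝ} {a : V} (h : ξ a = 0) :
    Commute (distDeriv 𝕜 a) (mulDist 𝕜 ξ) := by
  rw [Commute, SemiconjBy, distDeriv_mul_mulDist, h]
  simp

theorem lin_smul_comm (a : V) (p : SymAlg 𝕜 V) (T : TempDist 𝕜 V) :
    distDeriv 𝕜 a (p • T) = p • distDeriv 𝕜 a T := by
  rw [← lin_smul, ← lin_smul, smul_smul, smul_smul, mul_comm]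

theorem algebraMap_smul_dist (c : 𝕜) (T : TempDist 𝕜 V) :
    algebraMap 𝕜 (SymAlg 𝕜 V) c • T = c • T := by
  rw [smul_eq_diffOp, AlgHom.commutes]
  rfl

instance : IsScalarTower 𝕜 (SymAlg 𝕜 V) (TempDist 𝕜 V) where
  smul_assoc c p T := by rw [Algebra.smul_def, mul_smul, algebraMap_smul_dist]

theorem ι_tmul_smul (c : 𝕜) (a : V) (T : TempDist 𝕜 V) :
    SymmetricAlgebra.ι 𝕜 (𝕜 ⊗[ℝ] V) (c ⊗ₜ[ℝ] a) • T = c • distDeriv 𝕜 a T := by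
  have : c ⊗ₜ[ℝ] a = c • ((1 : 𝕜) ⊗ₜ[ℝ] a) := by simp [TensorProduct.smul_tmul']
  rw [this, map_smul, smul_assoc, ← lin_smul]
  rfl

/-- A space of distributions closed under derivatives is closed under `S[V]`. -/
theorem smul_mem_of_distDeriv (P : Submodule 𝕜 (TempDist 𝕜 V))
    (hP : ∀ a, ∀ T ∈ P, distDeriv 𝕜 a T ∈ P) (p : SymAlg 𝕜 V) : ∀ T ∈ P, p • T ∈ P := by
  induction p using SymmetricAlgebra.induction with
  | algebraMap c =>
      intro T hT
      rw [algebraMap_smul_dist]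
      exact P.smul_mem c hT
  | ι x =>
      intro T hT
      induction x using TensorProduct.induction_on with
      | zero =>
        rw [map_zero]
        exact (zero_smul (SymAlg 𝕜 V) T).symm ▸ P.zero_mem
      | tmul c a =>
        rw [ι_tmul_smul]
        exact P.smul_mem c (hP a T hT)
      | add x y hx hy =>
        rw [map_add, add_smul]
        exact P.add_mem hx hy
  | mul p q hp hq =>
      intro T hT
      rw [mul_smul]
      exact hp _ (hq _ hT)
  | add p q hp hq =>
      intro T hT
      rw [add_smul]
      exact P.add_mem (hp _ hT) (hq _ hT)

theorem pow_mulDist_eq_zero_mono {ξ : V →L[ℝ] ℝ} {T : TempDist 𝕜 V} {n k : ℕ} (hnk : n ≤ k)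
    (h : (mulDist 𝕜 ξ ^ n) T = 0) : (mulDist 𝕜 ξ ^ k) T = 0 := by
  obtain ⟨d, rfl⟩ := Nat.exists_eq_add_of_le' hnk
  rw [pow_add, Module.End.mul_apply, h, map_zero]

variable (𝕜)

/-- The distributions killed by a power of the multiplication by `ξ`. -/
def nilpotentDist (ξ : V →L[ℝ] ℝ) : Submodule 𝕜 (TempDist 𝕜 V) where
  carrier := {T | ∃ n : ℕ, (mulDist 𝕜 ξ ^ n) T = 0}
  add_mem' := by
    rintro S T ⟨n, hn⟩ ⟨k, hk⟩
    exact ⟨max n k, by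
      rw [map_add, pow_mulDist_eq_zero_mono (le_max_left n k) hn,
        pow_mulDist_eq_zero_mono (le_max_right n k) hk, add_zero]⟩
  zero_mem' := ⟨0, by simp⟩
  smul_mem' := by
    rintro c T ⟨n, hn⟩
    exact ⟨n, by rw [map_smul, hn]; exact smul_zero (A := TempDist 𝕜 V) c⟩

variable {𝕜}

/-- By [∂_a, ξ^(n+1)] = (n+1) ξ(a) ξ^n, a derivative raises the order of nilpotency by at most one.
-/
theorem distDeriv_mem_nilpotentDist {ξ : V →L[ℝ] ℝ} (a : V) {T : TempDist 𝕜 V}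
    (hT : T ∈ nilpotentDist 𝕜 ξ) : distDeriv 𝕜 a T ∈ nilpotentDist 𝕜 ξ := by
  obtain ⟨n, hn⟩ := hT
  refine ⟨n + 1, ?_⟩
  have h := congrArg (fun L : Module.End 𝕜 (TempDist 𝕜 V) => L T)
    (distDeriv_mul_mulDist_pow (𝕜 := 𝕜) ξ a n)
  simp only [Module.End.mul_apply, LinearMap.add_apply, LinearMap.smul_apply, hn, smul_zero,
    add_zero, pow_mulDist_eq_zero_mono n.le_succ hn, map_zero] at h
  exact h.symm

variable (𝕜)

/-- The distributions that are killed by powers of all linear forms vanishing on `r`. -/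
def nearDist (r : Submodule ℝ V) : Submodule (SymAlg 𝕜 V) (TempDist 𝕜 V) where
  carrier := {T | ∀ ξ : V →L[ℝ] ℝ, (∀ v ∈ r, ξ v = 0) → T ∈ nilpotentDist 𝕜 ξ}
  add_mem' hS hT ξ hξ := add_mem (hS ξ hξ) (hT ξ hξ)
  zero_mem' _ _ := zero_mem _
  smul_mem' p T hT ξ hξ := smul_mem_of_distDeriv _
    (fun a _ hS => distDeriv_mem_nilpotentDist a hS) p T (hT ξ hξ)

variable {𝕜}

theorem mulDist_extend {r : Submodule ℝ V} {ξ : V →L[ℝ] ℝ} (hξ : ∀ v ∈ r, ξ v = 0)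
    (φ : TempDist 𝕜 r) : mulDist 𝕜 ξ (extend 𝕜 r φ) = 0 := by
  ext f
  rw [mulDist_apply, extend_apply]
  have : restrict 𝕜 r (SchwartzMap.smulLeftCLM 𝕜 (fun x => (ξ x : 𝕜)) f) = 0 := by
    ext x
    rw [restrict_apply, smulLeft_linear_apply, hξ x x.2]
    simp
  rw [this, map_zero]
  rfl

/-- The image of j is not stable under transversal derivatives, whereas `nearDist` is an
S[V]-module. This inclusion is all that is needed to pass from 𝒢(X) to that module. -/
theorem distOn_subset_nearDist (r : Submodule ℝ V) {T : TempDist 𝕜 V} (hT : T ∈ distOn 𝕜 r) :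
    T ∈ nearDist 𝕜 r := by
  obtain ⟨φ, rfl⟩ := hT
  exact fun ξ hξ => ⟨1, by rw [pow_one, mulDist_extend hξ]⟩

/-- Kashiwara's lemma for one linear form. -/
theorem mem_span_ker_of_pow (P : Submodule 𝕜 (TempDist 𝕜 V)) {ξ : V →L[ℝ] ℝ} {e : V}
    (he : ξ e = 1) (hM : ∀ T ∈ P, mulDist 𝕜 ξ T ∈ P) (hD : ∀ T ∈ P, distDeriv 𝕜 e T ∈ P)
    (n : ℕ) : ∀ T ∈ P, (mulDist 𝕜 ξ ^ n) T = 0 →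
      T ∈ Submodule.span (SymAlg 𝕜 V) {h | h ∈ P ∧ mulDist 𝕜 ξ h = 0} := by
  induction n with
  | zero =>
      intro T _ h
      rw [pow_zero, Module.End.one_apply] at h
      rw [h]
      exact zero_mem _
  | succ n ih =>
    intro T hT h
    obtain _ | n := n
    · exact Submodule.subset_span ⟨hT, by simpa using h⟩
    -- Here ξ^(n+2) T = 0. Both ξT and (∂_e ξ + (n+1)) T are killed by ξ^(n+1), the second by the
    -- commutation rule. Subtracting ∂_e (ξT) leaves (n+1) T in the span, and n+1 is invertible.
    have h1 := ih _ (hM T hT) (by rwa [← Module.End.mul_apply, ← pow_succ])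
    have h2 := ih (distDeriv 𝕜 e (mulDist 𝕜 ξ T) + (n + 1 : 𝕜) • T)
      (P.add_mem (hD _ (hM _ hT)) (P.smul_mem _ hT)) (by
        have h3 := congrArg (fun L : Module.End 𝕜 (TempDist 𝕜 V) => L (mulDist 𝕜 ξ T))
          (distDeriv_mul_mulDist_pow (𝕜 := 𝕜) ξ e n)
        simp only [Module.End.mul_apply, LinearMap.add_apply, LinearMap.smul_apply, he,
          RCLike.ofReal_one, mul_one] at h3
        rw [← Module.End.mul_apply (mulDist 𝕜 ξ ^ (n + 1)), ← pow_succ, h, map_zero,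
          ← Module.End.mul_apply (mulDist 𝕜 ξ ^ n), ← pow_succ] at h3
        rw [map_add, map_smul]
        exact h3.symm)
    have h4 : (n + 1 : 𝕜) • T ∈
        Submodule.span (SymAlg 𝕜 V) {h | h ∈ P ∧ mulDist 𝕜 ξ h = 0} := by
      have := sub_mem h2 (Submodule.smul_mem _ (lin 𝕜 e) h1)
      rwa [lin_smul, add_sub_cancel_left] at this
    have h5 := Submodule.smul_mem _ (algebraMap 𝕜 (SymAlg 𝕜 V) (n + 1 : 𝕜)⁻¹) h4
    rwa [algebraMap_smul_dist, inv_smul_smul₀ (by exact_mod_cast n.succ_ne_zero)] at h5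

/-- Kashiwara's lemma for a family of linear forms. -/
theorem mem_span_iInf_ker (P : Submodule 𝕜 (TempDist 𝕜 V)) {κ : Type*} [Fintype κ]
    [DecidableEq κ] {ξ : κ → V →L[ℝ] ℝ} {e : κ → V}
    (he : ∀ i j, ξ i (e j) = if i = j then 1 else 0)
    (hM : ∀ i, ∀ T ∈ P, mulDist 𝕜 (ξ i) T ∈ P) (hD : ∀ i, ∀ T ∈ P, distDeriv 𝕜 (e i) T ∈ P)
    {T : TempDist 𝕜 V} (hT : T ∈ P) (hn : ∀ i, T ∈ nilpotentDist 𝕜 (ξ i)) :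
    T ∈ Submodule.span (SymAlg 𝕜 V) {h | h ∈ P ∧ ∀ i, mulDist 𝕜 (ξ i) h = 0} := by
  have key (s : Finset κ) : T ∈ Submodule.span (SymAlg 𝕜 V)
      {h | (h ∈ P ∧ ∀ i, h ∈ nilpotentDist 𝕜 (ξ i)) ∧ ∀ i ∈ s, mulDist 𝕜 (ξ i) h = 0} := by
    induction s using Finset.induction_on with
    | empty => exact Submodule.subset_span ⟨⟨hT, hn⟩, by simp⟩
    | insert i s his ih =>
      refine Submodule.span_le.2 ?_ ih
      rintro h ⟨⟨hP, hnil⟩, hs⟩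
      -- Q records everything achieved so far. It is stable under ξ_i because multiplications
      -- commute, and under ∂_{e_i} because ξ_j(e_i) = 0 for the forms ξ_j, j ∈ s, already treated.
      let Q : Submodule 𝕜 (TempDist 𝕜 V) :=
        (P ⊓ ⨅ j, nilpotentDist 𝕜 (ξ j)) ⊓ ⨅ j ∈ s, LinearMap.ker (mulDist 𝕜 (ξ j))
      have hQ (S : TempDist 𝕜 V) : S ∈ Q ↔ (S ∈ P ∧ ∀ j, S ∈ nilpotentDist 𝕜 (ξ j)) ∧
          ∀ j ∈ s, mulDist 𝕜 (ξ j) S = 0 := by simp [Q]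
      obtain ⟨n, hn⟩ := hnil i
      refine Submodule.span_mono ?_ (mem_span_ker_of_pow Q (e := e i) (by simp [he]) ?_ ?_ n h
        ((hQ h).2 ⟨⟨hP, hnil⟩, hs⟩) hn)
      · rintro S ⟨hSQ, hSi⟩
        rw [hQ] at hSQ
        refine ⟨hSQ.1, fun j hj => ?_⟩
        rcases Finset.mem_insert.1 hj with rfl | hj
        · exact hSi
        · exact hSQ.2 j hj
      · intro S hS
        rw [hQ] at hS ⊢
        refine ⟨⟨hM i S hS.1.1, fun j => ?_⟩, fun j hj => ?_⟩
        · obtain ⟨k, hk⟩ := hS.1.2 j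
          refine ⟨k, ?_⟩
          rw [← Module.End.mul_apply, (Commute.pow_left (mulDist_comm (𝕜 := 𝕜) (ξ j) (ξ i)) k).eq,
            Module.End.mul_apply, hk, map_zero]
        · rw [← Module.End.mul_apply, mulDist_comm, Module.End.mul_apply, hS.2 j hj, map_zero]
      · intro S hS
        rw [hQ] at hS ⊢
        refine ⟨⟨hD i S hS.1.1, fun j => distDeriv_mem_nilpotentDist _ (hS.1.2 j)⟩,
          fun j hj => ?_⟩
        have hji : ξ j (e i) = 0 := by
          rw [he, if_neg]
          rintro rfl
          exact his hj
        rw [← Module.End.mul_apply, ← (commute_distDeriv_mulDist hji).eq, Module.End.mul_apply,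
          hS.2 j hj, map_zero]
  refine Submodule.span_mono ?_ (key Finset.univ)
  rintro S ⟨hS, hS'⟩
  exact ⟨hS.1, fun i => hS' i (Finset.mem_univ i)⟩

end Weyl

/-! ### Splines oriented by a linear form. -/

section Orient

variable {V : Type*} [NormedAddCommGroup V] [NormedSpace ℝ V] {m : ℕ}

open scoped Classical in
/-- The modes that are the full line on `ℓ`, that have the sign of `ξ(X_i)` on `Y`, and that are
trivial elsewhere. -/
def orient (X : Fin m → V) (ξ : V →L[ℝ] ℝ) (ℓ Y : Finset (Fin m)) (i : Fin m) : Mode :=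
  if i ∈ ℓ then Mode.line else if i ∈ Y then if 0 < ξ (X i) then Mode.pos else Mode.neg
  else Mode.zero

variable {X : Fin m → V} {ξ : V →L[ℝ] ℝ} {ℓ Y : Finset (Fin m)} {i : Fin m}

theorem orient_of_mem_line (h : i ∈ ℓ) : orient X ξ ℓ Y i = Mode.line := by simp [orient, h]

theorem orient_of_notMem (h : i ∉ ℓ) (h' : i ∉ Y) : orient X ξ ℓ Y i = Mode.zero := by
  simp [orient, h, h']

theorem orient_of_mem (h : i ∉ ℓ) (h' : i ∈ Y) :
    orient X ξ ℓ Y i = Mode.pos ∨ orient X ξ ℓ Y i = Mode.neg := by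
  by_cases h0 : 0 < ξ (X i) <;> simp [orient, h, h', h0]

/-- Applying ξ to ∑ t_i X_i = 0 gives a vanishing sum of nonnegative terms, which forces t_i = 0 off
ℓ. Independence of the X_i, i ∈ ℓ, finishes. -/
theorem admissible_orient (hℓ : LinearIndepOn ℝ X (ℓ : Set (Fin m))) (h0 : ∀ i ∈ ℓ, ξ (X i) = 0)
    (hY : ∀ i ∈ Y, i ∉ ℓ → ξ (X i) ≠ 0) : Admissible X (orient X ξ ℓ Y) := by
  intro t ht hsum
  have h1 : ∑ i, t i * ξ (X i) = 0 := by
    simpa using congrArg ξ hsum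
  have hnn : ∀ i, 0 ≤ t i * ξ (X i) := fun i => by
    have hti := ht i
    by_cases hi : i ∈ ℓ
    · simp [h0 i hi]
    by_cases hi' : i ∈ Y
    · by_cases hp : 0 < ξ (X i)
      · have : 0 ≤ t i := by simpa [orient, hi, hi', hp, Mode.cone] using hti
        positivity
      · have : t i ≤ 0 := by simpa [orient, hi, hi', hp, Mode.cone] using hti
        exact mul_nonneg_of_nonpos_of_nonpos this (not_lt.1 hp)
    · have : t i = 0 := by simpa [orient, hi, hi', Mode.cone] using hti
      simp [this]
  have h2 := (Finset.sum_eq_zero_iff_of_nonneg fun i _ => hnn i).1 h1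
  have h3 : ∀ i, i ∉ ℓ → t i = 0 := fun i hi => by
    by_cases hi' : i ∈ Y
    · exact (mul_eq_zero.1 (h2 i (Finset.mem_univ i))).resolve_right (hY i hi' hi)
    · simpa [orient, hi, hi', Mode.cone] using ht i
  have h4 : ∑ i ∈ ℓ, t i • X i = 0 := by
    rw [← hsum]
    exact Finset.sum_subset (Finset.subset_univ _) fun i _ hi => by rw [h3 i hi, zero_smul]
  ext i
  by_cases hi : i ∈ ℓ
  · exact linearIndepOn_finset_iff.1 hℓ t h4 i hi
  · exact h3 i hi

variable {𝕜 : Type*} [RCLike 𝕜]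

theorem pi_dirac {ι : Type*} [Fintype ι] (a : ι → ℝ) :
    Measure.pi (fun i => Measure.dirac (a i)) = Measure.dirac a := by
  classical
  refine Measure.pi_eq fun s hs => ?_
  rw [Measure.dirac_apply' _ (MeasurableSet.univ_pi hs)]
  simp only [Measure.dirac_apply' _ (hs _), Set.indicator_apply, Pi.one_apply, Set.mem_univ_pi,
    Finset.prod_ite_zero, Finset.prod_const_one, Finset.mem_univ, true_implies]

theorem integral_paramMeasure_orient (X : Fin m → V) (ξ : V →L[ℝ] ℝ) (ℓ : Finset (Fin m))
    {g : V → 𝕜} (hg : Continuous g) :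
    ∫ t, g (∑ i, t i • X i) ∂paramMeasure (orient X ξ ℓ ∅) =
      ∫ t : EuclideanSpace ℝ ℓ, g (∑ i, t i • X i) := by
  classical
  have hmp := (measurePreserving_piEquivPiSubtypeProd
    (fun i => (orient X ξ ℓ ∅ i).measure) (fun i => i ∈ ℓ)).symm
  have h1 : (fun i : {i // i ∈ ℓ} => (orient X ξ ℓ ∅ i).measure) = fun _ => volume := by
    ext1 i
    rw [orient_of_mem_line i.2]
    rfl
  have h2 : (fun i : {i // i ∉ ℓ} => (orient X ξ ℓ ∅ i).measure) =
      fun i => Measure.dirac ((0 : {i // i ∉ ℓ} → ℝ) i) := by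
    ext1 i
    rw [orient_of_notMem i.2 (Finset.notMem_empty _)]
    rfl
  have h3 : @Measure.pi {i // i ∈ ℓ} (fun _ => ℝ) (Subtype.fintype _) _ (fun _ => volume) =
      (volume : Measure (ℓ → ℝ)) := by
    rw [volume_pi]
    congr!
  rw [h1, h2, pi_dirac, Measure.prod_dirac, h3] at hmp
  have hF : Continuous fun t : Fin m → ℝ => g (∑ i, t i • X i) := hg.comp (by fun_prop)
  have hsm : StronglyMeasurable fun x => g (∑ i, (MeasurableEquiv.piEquivPiSubtypeProd
      (fun _ : Fin m => ℝ) (fun i => i ∈ ℓ)).symm x i • X i) :=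
    hF.stronglyMeasurable.comp_measurable (MeasurableEquiv.measurable _)
  rw [paramMeasure, ← hmp.integral_comp (MeasurableEquiv.measurableEmbedding _), integral_map
    (by fun_prop) hsm.aestronglyMeasurable, ← (PiLp.volume_preserving_toLp ℓ).integral_comp
      (MeasurableEquiv.toLp 2 (ℓ → ℝ)).measurableEmbedding
      (fun t : EuclideanSpace ℝ ℓ => g (∑ i, t i • X i))]
  refine integral_congr_ae (Filter.Eventually.of_forall fun t => ?_)
  have hu (i : Fin m) : (MeasurableEquiv.piEquivPiSubtypeProd (fun _ : Fin m => ℝ)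
      (fun i => i ∈ ℓ)).symm (t, 0) i = if h : i ∈ ℓ then t ⟨i, h⟩ else 0 := rfl
  have h4 : ∑ i, (MeasurableEquiv.piEquivPiSubtypeProd (fun _ : Fin m => ℝ)
      (fun i => i ∈ ℓ)).symm (t, 0) i • X i = ∑ i : ℓ, t i • X i := by
    rw [← Finset.sum_subset (Finset.subset_univ ℓ) fun i _ hi => by simp [hu, hi],
      ← Finset.sum_coe_sort]
    exact Finset.sum_congr rfl fun i _ => by simp [hu]
  exact congrArg g h4

end Orient

/-! ### The base case: invariant distributions concentrated near a subspace. -/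

section Base

variable {V : Type*} [NormedAddCommGroup V] [NormedSpace ℝ V] [FiniteDimensional ℝ V] {m : ℕ}

theorem exists_adapted_coordinates {V : Type u} [NormedAddCommGroup V] [NormedSpace ℝ V]
    [FiniteDimensional ℝ V] {ι : Type*} [Fintype ι] [DecidableEq ι] {v : ι → V}
    (hv : LinearIndependent ℝ v) :
    ∃ (κ : Type u) (_ : Fintype κ) (_ : DecidableEq κ) (ξ : κ → V →L[ℝ] ℝ) (e : κ → V)
      (p : V →L[ℝ] EuclideanSpace ℝ ι),
      (∀ i j, ξ i (e j) = if i = j then 1 else 0) ∧ (∀ j i, ξ j (v i) = 0) ∧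
      (∀ i, p (v i) = EuclideanSpace.single i (1 : ℝ)) ∧
      ∀ x, x = ∑ i, p x i • v i + ∑ j, ξ j x • e j := by
  classical
  let b := Module.Basis.sumExtend hv
  have hb (i : ι) : b (Sum.inl i) = v i := by
    simp only [b, Module.Basis.sumExtend, Module.Basis.reindex_apply, Module.Basis.extend_apply_self]
    rfl
  have : Finite (ι ⊕ Module.Basis.sumExtendIndex hv) := Module.Finite.finite_basis b
  have : Finite (Module.Basis.sumExtendIndex hv) := Finite.sum_right ι
  let _ := Fintype.ofFinite (Module.Basis.sumExtendIndex hv)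
  let p₀ : V →ₗ[ℝ] EuclideanSpace ℝ ι :=
    (WithLp.linearEquiv 2 ℝ (ι → ℝ)).symm.toLinearMap ∘ₗ
      LinearMap.pi fun i => b.coord (Sum.inl i)
  have hp (x : V) (i : ι) : p₀ x i = b.repr x (Sum.inl i) := rfl
  refine ⟨Module.Basis.sumExtendIndex hv, inferInstance, inferInstance,
    fun j => (b.coord (Sum.inr j)).toContinuousLinearMap, fun j => b (Sum.inr j),
    p₀.toContinuousLinearMap, fun i j => ?_, fun j i => ?_, fun i => ?_, fun x => ?_⟩
  · simp [Finsupp.single_apply, eq_comm]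
  · simp [← hb]
  · ext k
    simp [hp, ← hb, Finsupp.single_apply, eq_comm]
  · conv_lhs => rw [← b.sum_repr x, Fintype.sum_sum_type]
    simp [hp, hb]

variable {𝕜 : Type*} [RCLike 𝕜]

/-- A distribution that is invariant under the span of the independent vectors `v_i` and that is
killed by the linear forms vanishing on them annihilates the Schwartz functions whose integral
over this span is zero. -/
theorem apply_eq_zero_of_integral_eq_zero {ι : Type*} [Fintype ι] [DecidableEq ι] {v : ι → V}
    {κ : Type*} [Fintype κ] {ξ : κ → V →L[ℝ] ℝ} {e : κ → V} {p : V →L[ℝ] EuclideanSpace ℝ ι}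
    (hξv : ∀ j i, ξ j (v i) = 0) (hpv : ∀ i, p (v i) = EuclideanSpace.single i (1 : ℝ))
    (hx : ∀ x, x = ∑ i, p x i • v i + ∑ j, ξ j x • e j)
    {h : TempDist 𝕜 V} (hinv : ∀ i, distDeriv 𝕜 (v i) h = 0) (hker : ∀ j, mulDist 𝕜 (ξ j) h = 0)
    (g : 𝓢(V, 𝕜)) (hg : ∫ t : EuclideanSpace ℝ ι, g (∑ i, t i • v i) = 0) : h g = 0 := by
  let A : EuclideanSpace ℝ ι →L[ℝ] V := ∑ i, (EuclideanSpace.proj (𝕜 := ℝ) i).smulRight (v i)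
  have hA (t : EuclideanSpace ℝ ι) : A t = ∑ i, t i • v i := by simp [A]
  let q : V →L[ℝ] V := ∑ j, (ξ j).smulRight (e j)
  have hq (x : V) : q x = ∑ j, ξ j x • e j := by simp [q]
  have hpA (t : EuclideanSpace ℝ ι) : p (A t) = t := by
    ext k
    simp [hA, hpv, Finset.sum_apply, Pi.single_apply]
  have hqA (t : EuclideanSpace ℝ ι) : q (A t) = 0 := by
    simp [hA, hq, hξv]
  have hAs (i : ι) : A (EuclideanSpace.single i (1 : ℝ)) = v i := by
    simp [hA, ite_smul]
  -- The restriction g' of g to the span has integral zero, so it is a sum of derivatives of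
  -- functions G_i. Each G_i is extended to V as H_i(x) = μ(q x) G_i(p x), with μ a cutoff in the
  -- transversal direction. Then g - ∑ ∂_{v_i} H_i vanishes on the span, and Hadamard's lemma writes
  -- it as ∑ ξ_j K_j; h annihilates all these terms.
  obtain ⟨g', hg'⟩ := exists_comp_of_leftInverse g A p hpA
  obtain ⟨G, hG⟩ := exists_eq_sum_lineDeriv g' (by simpa only [hg', hA] using hg)
  obtain ⟨μ, hμ⟩ := exists_schwartz_one (V := V)
  choose H hH using fun i => exists_comp_of_leftInverse (tensor (G i) μ) (p.prod q)
    (A.coprod (ContinuousLinearMap.id ℝ V)) (fun x => by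
      conv_rhs => rw [hx x]
      simp [hA, hq])
  have hHA (i : ι) (t : EuclideanSpace ℝ ι) : H i (A t) = G i t := by
    simp [hH, hpA, hqA, hμ]
  have hdH (i : ι) (t : EuclideanSpace ℝ ι) :
      (∂_{v i} (H i)) (A t) = (∂_{EuclideanSpace.single i (1 : ℝ)} (G i)) t := by
    rw [SchwartzMap.lineDerivOp_apply, SchwartzMap.lineDerivOp_apply, lineDeriv, lineDeriv]
    congr 1
    ext s
    rw [← hHA, A.map_add, A.map_smul, hAs]
  let k : 𝓢(V, 𝕜) := g - ∑ i, ∂_{v i} (H i)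
  have hk : ∀ x, k (x - ∑ j, ξ j x • e j) = 0 := fun x => by
    have h1 : x - ∑ j, ξ j x • e j = A (p x) := by
      rw [hA, sub_eq_iff_eq_add]
      exact hx x
    rw [h1]
    simp only [k, sub_apply, sum_apply, hdH, ← hg']
    rw [hG, sum_apply, sub_self]
  obtain ⟨K, hK⟩ := exists_eq_sum_smul ξ e k hk
  have h1 : k = ∑ j, SchwartzMap.smulLeftCLM 𝕜 (fun x => (ξ j x : 𝕜)) (K j) := by
    ext x
    rw [hK, sum_apply]
    refine Finset.sum_congr rfl fun j _ => ?_
    rw [smulLeft_linear_apply, RCLike.real_smul_eq_coe_mul]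
  have h2 : h k = 0 := by
    rw [h1, map_sum]
    refine Finset.sum_eq_zero fun j _ => ?_
    rw [← mulDist_apply, hker]
    rfl
  have h3 (i : ι) : h (∂_{v i} (H i)) = 0 := by
    have := congrArg (fun T : TempDist 𝕜 V => T (H i)) (hinv i)
    change h (-∂_{v i} (H i)) = 0 at this
    rwa [map_neg, neg_eq_zero] at this
  simpa [k, map_sub, map_sum, h3] using h2

/-- The equations ξ_j of the span kill the vectors X_i, so multiplication by them preserves
invariance. Kashiwara's lemma may therefore be applied inside the invariant distributions. -/
theorem mem_span_modeSpline_line {X : Fin m → V} {ℓ : Finset (Fin m)}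
    (hℓ : LinearIndepOn ℝ X (ℓ : Set (Fin m))) {T : TempDist 𝕜 V}
    (hinv : ∀ i ∈ ℓ, distDeriv 𝕜 (X i) T = 0)
    (hT : T ∈ nearDist 𝕜 (Submodule.span ℝ (X '' ℓ))) :
    T ∈ Submodule.span (SymAlg 𝕜 V) {modeSpline 𝕜 X (orient X 0 ℓ ∅)} := by
  have hadm : Admissible X (orient X 0 ℓ ∅) := admissible_orient hℓ (by simp) (by simp)
  obtain ⟨κ, _, _, ξ, e, p, hξe, hξv, hpv, hx⟩ :=
    exists_adapted_coordinates (v := fun i : ℓ => X i) hℓ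
  let P : Submodule 𝕜 (TempDist 𝕜 V) := ⨅ i : ℓ, LinearMap.ker (distDeriv 𝕜 (X i))
  have hP (S : TempDist 𝕜 V) : S ∈ P ↔ ∀ i : ℓ, distDeriv 𝕜 (X i) S = 0 := by simp [P]
  have h1 := mem_span_iInf_ker P hξe (fun j S hS => by
      rw [hP] at hS ⊢
      intro i
      rw [← Module.End.mul_apply, (commute_distDeriv_mulDist (hξv j i)).eq, Module.End.mul_apply,
        hS i, map_zero]) (fun j S hS => by
      rw [hP] at hS ⊢
      intro i
      rw [← Module.End.mul_apply, distDeriv_comm, Module.End.mul_apply, hS i, map_zero])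
    ((hP T).2 fun i => hinv i i.2) (fun j => hT (ξ j) fun v hv => by
      have : Submodule.span ℝ (X '' ℓ) ≤ LinearMap.ker (ξ j).toLinearMap := by
        rw [Submodule.span_le]
        rintro _ ⟨i, hi, rfl⟩
        exact hξv j ⟨i, hi⟩
      exact this hv)
  refine Submodule.span_le.2 ?_ h1
  rintro h ⟨hh, hker⟩
  rw [hP] at hh
  have key (g : 𝓢(V, 𝕜)) (hg : modeSpline 𝕜 X (orient X 0 ℓ ∅) g = 0) : h g = 0 := by
    refine apply_eq_zero_of_integral_eq_zero hξv hpv hx hh hker g ?_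
    rw [hadm.modeSpline_apply, integral_paramMeasure_orient X 0 ℓ g.continuous, mul_eq_zero] at hg
    refine hg.resolve_left (Finset.prod_ne_zero_iff.2 fun i _ => ?_)
    cases orient X 0 ℓ ∅ i <;> simp [Mode.weight]
  -- A functional that vanishes on the kernel of another one is a multiple of it.
  obtain ⟨c, hc⟩ : ∃ c : 𝕜, h = c • modeSpline 𝕜 X (orient X 0 ℓ ∅) := by
    by_cases h0 : ∀ g, modeSpline 𝕜 X (orient X 0 ℓ ∅) g = 0
    · refine ⟨0, ?_⟩
      ext g
      rw [key g (h0 g)]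
      simp [h0]
    · push Not at h0
      obtain ⟨g₀, hg₀⟩ := h0
      refine ⟨h g₀ / modeSpline 𝕜 X (orient X 0 ℓ ∅) g₀, ?_⟩
      ext g
      have := key (g - (modeSpline 𝕜 X (orient X 0 ℓ ∅) g /
        modeSpline 𝕜 X (orient X 0 ℓ ∅) g₀) • g₀) (by
          rw [map_sub, map_smul, smul_eq_mul, div_mul_cancel₀ _ hg₀, sub_self])
      rw [map_sub, map_smul, smul_eq_mul, sub_eq_zero] at this
      rw [this]
      change _ = h g₀ / modeSpline 𝕜 X (orient X 0 ℓ ∅) g₀ * modeSpline 𝕜 X (orient X 0 ℓ ∅) g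
      ring
  rw [hc, ← algebraMap_smul_dist]
  exact Submodule.smul_mem _ _ (Submodule.mem_span_singleton_self _)

end Base

/-! ### The induction on the list of oriented directions. -/

section Induction

variable {𝕜 : Type*} [RCLike 𝕜] {V : Type*} [NormedAddCommGroup V] [NormedSpace ℝ V] {m : ℕ}
  {X : Fin m → V} {ξ : V →L[ℝ] ℝ} {ℓ Y : Finset (Fin m)}

theorem Admissible.prod_lin_smul_modeSpline {σ : Fin m → Mode} (h : Admissible X σ)
    (hX : ∀ i, X i ≠ 0) (s : Finset (Fin m)) (hs : ∀ i ∈ s, σ i = Mode.pos ∨ σ i = Mode.neg) :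
    (∏ i ∈ s, lin 𝕜 (X i)) • modeSpline 𝕜 X σ =
      modeSpline 𝕜 X (fun i => if i ∈ s then Mode.zero else σ i) := by
  induction s using Finset.induction_on with
  | empty => simp
  | insert a s ha ih =>
    rw [Finset.prod_insert ha, mul_smul, ih fun i hi => hs i (Finset.mem_insert_of_mem hi),
      lin_smul, Admissible.distDeriv_modeSpline _ (hX a)]
    · congr 1
      ext1 i
      rcases eq_or_ne i a with rfl | hi
      · simp
      · simp [hi]
    · simpa [ha] using hs a (Finset.mem_insert_self a s)
    · refine h.mono fun i => ?_
      split_ifs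
      · simpa [Mode.cone] using Mode.zero_mem_cone (σ i)
      · exact le_rfl

theorem ite_zero_orient {s : Finset (Fin m)} (hs : Disjoint s ℓ) :
    (fun i => if i ∈ s then Mode.zero else orient X ξ ℓ Y i) = orient X ξ ℓ (Y \ s) := by
  ext1 i
  by_cases hi : i ∈ s
  · rw [if_pos hi, orient_of_notMem (Finset.disjoint_left.1 hs hi) (by simp [hi])]
  · simp [orient, hi]

theorem prod_lin_smul_modeSpline_orient (hX : ∀ i, X i ≠ 0)
    (h : Admissible X (orient X ξ ℓ Y)) {s : Finset (Fin m)} (hsY : s ⊆ Y) (hs : Disjoint s ℓ) :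
    (∏ i ∈ s, lin 𝕜 (X i)) • modeSpline 𝕜 X (orient X ξ ℓ Y) =
      modeSpline 𝕜 X (orient X ξ ℓ (Y \ s)) := by
  rw [h.prod_lin_smul_modeSpline hX s fun i hi =>
    orient_of_mem (Finset.disjoint_left.1 hs hi) (hsY hi), ite_zero_orient hs]

theorem Admissible.mulDist_modeSpline {σ : Fin m → Mode} (h : Admissible X σ) {η : V →L[ℝ] ℝ}
    (hη : ∀ i, σ i ≠ Mode.zero → η (X i) = 0) : mulDist 𝕜 η (modeSpline 𝕜 X σ) = 0 := by
  ext f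
  rw [mulDist_apply, h.modeSpline_apply]
  have : ∫ t, SchwartzMap.smulLeftCLM 𝕜 (fun x => (η x : 𝕜)) f (∑ i, t i • X i)
      ∂paramMeasure σ = 0 := by
    refine integral_eq_zero_of_ae ?_
    filter_upwards [ae_mem_paramCone σ] with t ht
    have h1 : η (∑ i, t i • X i) = 0 := by
      rw [map_sum]
      refine Finset.sum_eq_zero fun i _ => ?_
      by_cases hi : σ i = Mode.zero
      · have : t i = 0 := by simpa [hi, Mode.cone] using ht i
        simp [this]
      · simp [hη i hi]
    rw [smulLeft_linear_apply, h1]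
    simp
  rw [this, mul_zero]
  rfl

theorem orient_congr {η : V →L[ℝ] ℝ} (h : ∀ i ∈ Y, 0 < η (X i) ↔ 0 < ξ (X i)) :
    orient X η ℓ Y = orient X ξ ℓ Y := by
  ext1 i
  by_cases hi : i ∈ Y
  · simp [orient, hi, h i hi]
  · simp [orient, hi]

variable (𝕜 X ℓ Y)

open scoped Classical in
/-- The distributions that are invariant under the `X_i`, `i ∈ ℓ`, and whose derivatives along the
members of `Y` outside of a rational subspace `r` containing these `X_i` are killed by powers of
the equations of `r`. -/
def spaceH : Submodule (SymAlg 𝕜 V) (TempDist 𝕜 V) where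
  carrier := {T | (∀ i ∈ ℓ, distDeriv 𝕜 (X i) T = 0) ∧
    ∀ r : Submodule ℝ V, IsRational X r → (∀ i ∈ ℓ, X i ∈ r) →
      (∏ i ∈ Y with X i ∉ r, lin 𝕜 (X i)) • T ∈ nearDist 𝕜 r}
  add_mem' hS hT := ⟨fun i hi => by rw [map_add, hS.1 i hi, hT.1 i hi, add_zero],
    fun r hr hℓ => by
      rw [smul_add]
      exact add_mem (hS.2 r hr hℓ) (hT.2 r hr hℓ)⟩
  zero_mem' := ⟨fun i _ => map_zero _, fun r _ _ => by
    rw [smul_zero]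
    exact zero_mem _⟩
  smul_mem' p T hT := ⟨fun i hi => by rw [lin_smul_comm, hT.1 i hi, smul_zero],
    fun r hr hℓ => by
      rw [smul_smul, mul_comm, mul_smul]
      exact Submodule.smul_mem _ p (hT.2 r hr hℓ)⟩

/-- The splines that are invariant under the `X_i`, `i ∈ ℓ`, and oriented on `Y` by a linear
form. -/
def genSet : Set (TempDist 𝕜 V) :=
  {T | ∃ ξ : V →L[ℝ] ℝ, (∀ i ∈ ℓ, ξ (X i) = 0) ∧ (∀ i ∈ Y, ξ (X i) ≠ 0) ∧
    T = modeSpline 𝕜 X (orient X ξ ℓ Y)}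

variable {𝕜 X ℓ Y}

/-- Differentiating along the members of Y outside r collapses their half-lines. Every remaining
direction lies in r, so the first power of each equation of r already kills the result. -/
theorem genSet_subset_spaceH (hX : ∀ i, X i ≠ 0)
    (hℓ : LinearIndepOn ℝ X (ℓ : Set (Fin m))) : genSet 𝕜 X ℓ Y ⊆ spaceH 𝕜 X ℓ Y := by
  classical
  rintro T ⟨ξ, h0, hY, rfl⟩
  have hadm := admissible_orient hℓ h0 fun i hi _ => hY i hi
  refine ⟨fun i hi => hadm.distDeriv_modeSpline_line (hX i) (orient_of_mem_line hi),
    fun r _ hr => ?_⟩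
  have hdisj : Disjoint (Y.filter fun i => X i ∉ r) ℓ :=
    Finset.disjoint_left.2 fun i hi hi' => (Finset.mem_filter.1 hi).2 (hr i hi')
  rw [prod_lin_smul_modeSpline_orient hX hadm (Finset.filter_subset _ _) hdisj]
  refine fun η hη => ⟨1, ?_⟩
  rw [pow_one]
  refine Admissible.mulDist_modeSpline (admissible_orient hℓ h0
    fun i hi _ => hY i (Finset.sdiff_subset hi)) fun i hi => hη _ ?_
  by_contra hir
  refine hi (orient_of_notMem (fun h => hir (hr i h)) ?_)
  simp [hir]

theorem exists_perturbation (ξ η : V →L[ℝ] ℝ) (hY : ∀ i ∈ Y, ξ (X i) ≠ 0) :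
    ∃ ε : ℝ, 0 < ε ∧ ∀ i ∈ Y, |ε * η (X i)| < |ξ (X i)| := by
  have h : ∀ᶠ ε : ℝ in nhdsWithin 0 (Set.Ioi 0), ∀ i ∈ Y, |ε * η (X i)| < |ξ (X i)| := by
    rw [Filter.eventually_all_finset]
    intro i hi
    have hc : Filter.Tendsto (fun ε : ℝ => |ε * η (X i)|) (nhds 0) (nhds |0 * η (X i)|) :=
      (by fun_prop : Continuous fun ε : ℝ => |ε * η (X i)|).tendsto 0
    exact (hc.mono_left nhdsWithin_le_nhds).eventually_lt_const (by simpa using hY i hi)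
  obtain ⟨ε, hε, hε0⟩ := (h.and self_mem_nhdsWithin).exists
  exact ⟨ε, hε0, hε⟩

theorem add_pos_iff_of_abs_lt {a b : ℝ} (h : |b| < |a|) : (0 < a + b ↔ 0 < a) ∧ a + b ≠ 0 := by
  rcases abs_cases a with ⟨h1, h2⟩ | ⟨h1, h2⟩ <;> rw [h1, abs_lt] at h <;>
    refine ⟨⟨fun _ => ?_, fun _ => ?_⟩, ?_⟩ <;> linarith

theorem isRational_span_image (X : Fin m → V) (s : Set (Fin m)) :
    IsRational X (Submodule.span ℝ (X '' s)) := by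
  refine le_antisymm (Submodule.span_mono ?_) (Submodule.span_le.2 Set.inter_subset_right)
  rintro _ ⟨i, hi, rfl⟩
  exact ⟨⟨i, rfl⟩, Submodule.subset_span ⟨i, hi, rfl⟩⟩

variable [FiniteDimensional ℝ V]

theorem exists_linear_form {a : Fin m} (ha : X a ∉ Submodule.span ℝ (X '' ℓ)) :
    ∃ η : V →L[ℝ] ℝ, (∀ i ∈ ℓ, η (X i) = 0) ∧ η (X a) = 1 := by
  obtain ⟨f, hfa, hf⟩ := Submodule.exists_le_ker_of_notMem ha
  refine ⟨(f (X a))⁻¹ • f.toContinuousLinearMap, fun i hi => ?_, ?_⟩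
  · have : f (X i) = 0 := hf (Submodule.subset_span ⟨i, hi, rfl⟩)
    simp [this]
  · simp [hfa]

/-- Generators for Y∖a can be integrated along X_a. If ξ(X_a) = 0, a small multiple of a form η with
η(X_a) = 1 and η = 0 on ℓ is added to ξ; this orients a without changing the other signs. -/
theorem span_genSet_erase_le (hX : ∀ i, X i ≠ 0) (hℓ : LinearIndepOn ℝ X (ℓ : Set (Fin m)))
    {a : Fin m} (ha : a ∈ Y) (haℓ : X a ∉ Submodule.span ℝ (X '' ℓ)) :
    Submodule.span (SymAlg 𝕜 V) (genSet 𝕜 X ℓ (Y.erase a)) ≤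
      (Submodule.span (SymAlg 𝕜 V) (genSet 𝕜 X ℓ Y)).map
        (LinearMap.lsmul (SymAlg 𝕜 V) (TempDist 𝕜 V) (lin 𝕜 (X a))) := by
  have haℓ' : a ∉ ℓ := fun h => haℓ (Submodule.subset_span ⟨a, h, rfl⟩)
  rw [Submodule.span_le]
  rintro _ ⟨ξ, h0, hY, rfl⟩
  obtain ⟨ξ', h0', hY', hsign⟩ : ∃ ξ' : V →L[ℝ] ℝ, (∀ i ∈ ℓ, ξ' (X i) = 0) ∧
      (∀ i ∈ Y, ξ' (X i) ≠ 0) ∧ ∀ i ∈ Y.erase a, 0 < ξ' (X i) ↔ 0 < ξ (X i) := by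
    by_cases hξa : ξ (X a) = 0
    · obtain ⟨η, hη, hηa⟩ := exists_linear_form haℓ
      obtain ⟨ε, hε, hεY⟩ := exists_perturbation ξ η hY
      refine ⟨ξ + ε • η, fun i hi => by simp [h0 i hi, hη i hi], fun i hi => ?_,
        fun i hi => (add_pos_iff_of_abs_lt (hεY i hi)).1⟩
      rcases eq_or_ne i a with rfl | hia
      · simp [hξa, hηa, hε.ne']
      · exact (add_pos_iff_of_abs_lt (hεY i (Finset.mem_erase.2 ⟨hia, hi⟩))).2
    · refine ⟨ξ, h0, fun i hi => ?_, fun _ _ => Iff.rfl⟩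
      rcases eq_or_ne i a with rfl | hia
      · exact hξa
      · exact hY i (Finset.mem_erase.2 ⟨hia, hi⟩)
  refine ⟨_, Submodule.subset_span ⟨ξ', h0', hY', rfl⟩, ?_⟩
  have := prod_lin_smul_modeSpline_orient (𝕜 := 𝕜) hX
    (admissible_orient hℓ h0' fun i hi _ => hY' i hi) (Finset.singleton_subset_iff.2 ha)
    (Finset.disjoint_singleton_left.2 haℓ')
  rw [Finset.prod_singleton, Finset.sdiff_singleton_eq_erase, orient_congr hsign] at this
  exact this

-- The full line along X_a is a signed difference of half-lines, selected by the two tilts ξ ± εη.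
-- Both tilts agree with ξ in sign on Y' and are nonzero on all of Y. Hence each half-line spline is
-- a derivative, along the other members of Y that fell into the enlarged span, of a generator for
-- (ℓ, Y).
open scoped Classical in
theorem genSet_insert_subset (hX : ∀ i, X i ≠ 0) (hℓ : LinearIndepOn ℝ X (ℓ : Set (Fin m)))
    (hYℓ : ∀ i ∈ Y, X i ∉ Submodule.span ℝ (X '' ℓ)) {a : Fin m} (ha : a ∈ Y) :
    genSet 𝕜 X (insert a ℓ)
      (Y.filter fun i => X i ∉ Submodule.span ℝ (X '' (insert a ℓ : Finset (Fin m)))) ⊆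
      Submodule.span (SymAlg 𝕜 V) (genSet 𝕜 X ℓ Y) := by
  have hdisj : ∀ i ∈ Y, i ∉ ℓ := fun i hi h => hYℓ i hi (Submodule.subset_span ⟨i, h, rfl⟩)
  have hℓ' : LinearIndepOn ℝ X ((insert a ℓ : Finset (Fin m)) : Set (Fin m)) := by
    rw [Finset.coe_insert]
    exact hℓ.insert (hYℓ a ha)
  set Y' := Y.filter fun i => X i ∉ Submodule.span ℝ (X '' (insert a ℓ : Finset (Fin m))) with hY'
  have haY' : a ∉ Y' := fun h => (Finset.mem_filter.1 h).2
    (Submodule.subset_span ⟨a, Finset.mem_insert_self a ℓ, rfl⟩)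
  rintro _ ⟨ξ, h0, hξY, rfl⟩
  obtain ⟨η, hη, hηa⟩ := exists_linear_form (hYℓ a ha)
  obtain ⟨ε, hε, hεY⟩ := exists_perturbation ξ η hξY
  have hspan : Submodule.span ℝ (X '' (insert a ℓ : Finset (Fin m))) ≤
      LinearMap.ker ξ.toLinearMap := by
    rw [Submodule.span_le]
    rintro _ ⟨i, hi, rfl⟩
    exact h0 i hi
  -- Such an X_i equals c X_a + u with u in the span of ℓ, so η(X_i) = c; and c ≠ 0 because X_i is
  -- not in that span.
  have hηY : ∀ i ∈ Y, i ∉ Y' → η (X i) ≠ 0 := fun i hi hi' => by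
    have h1 : X i ∈ Submodule.span ℝ (X '' (insert a ℓ : Finset (Fin m))) := by
      by_contra h
      exact hi' (Finset.mem_filter.2 ⟨hi, h⟩)
    rw [Finset.coe_insert, Set.image_insert_eq, Submodule.mem_span_insert] at h1
    obtain ⟨c, u, hu, hcu⟩ := h1
    have h2 : η u = 0 := by
      have : Submodule.span ℝ (X '' ℓ) ≤ LinearMap.ker η.toLinearMap := by
        rw [Submodule.span_le]
        rintro _ ⟨i, hi, rfl⟩
        exact hη i hi
      exact this hu
    rw [hcu, map_add, map_smul, hηa, h2, smul_eq_mul, mul_one, add_zero]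
    rintro rfl
    apply hYℓ i hi
    rw [hcu, zero_smul, zero_add]
    exact hu
  have key (δ : ℝ) (hδ : |δ| = ε) (c : Mode) (hc : c = if 0 < δ then Mode.pos else Mode.neg) :
      modeSpline 𝕜 X (Function.update (orient X ξ (insert a ℓ) Y') a c) ∈
        Submodule.span (SymAlg 𝕜 V) (genSet 𝕜 X ℓ Y) := by
    have hδ0 : δ ≠ 0 := by
      rintro rfl
      rw [abs_zero] at hδ
      exact hε.ne hδ
    have habs : ∀ i ∈ Y', |δ * η (X i)| < |ξ (X i)| := fun i hi => by
      rw [abs_mul, hδ, ← abs_of_pos hε, ← abs_mul]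
      exact hεY i hi
    have hζ0 : ∀ i ∈ ℓ, (ξ + δ • η) (X i) = 0 := fun i hi => by
      simp [h0 i (Finset.mem_insert_of_mem hi), hη i hi]
    have hζY : ∀ i ∈ Y, (ξ + δ • η) (X i) ≠ 0 := fun i hi => by
      by_cases hi' : i ∈ Y'
      · exact (add_pos_iff_of_abs_lt (habs i hi')).2
      · have h1 : ξ (X i) = 0 := hspan (by
          by_contra h
          exact hi' (Finset.mem_filter.2 ⟨hi, h⟩))
        simp [h1, hδ0, hηY i hi hi']
    have h1 := prod_lin_smul_modeSpline_orient (𝕜 := 𝕜) hX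
      (admissible_orient hℓ hζ0 fun i hi _ => hζY i hi) (s := Y \ insert a Y')
      Finset.sdiff_subset (Finset.disjoint_left.2 fun i hi => hdisj i (Finset.sdiff_subset hi))
    have h2 : Y \ (Y \ insert a Y') = insert a Y' := by
      rw [Finset.sdiff_sdiff_eq_self]
      exact Finset.insert_subset ha (Finset.filter_subset _ _)
    have h3 : orient X (ξ + δ • η) ℓ (insert a Y') =
        Function.update (orient X ξ (insert a ℓ) Y') a c := by
      ext1 i
      rcases eq_or_ne i a with rfl | hia
      · have : ξ (X i) = 0 := h0 i (Finset.mem_insert_self i ℓ)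
        simp [orient, hdisj i ha, this, hηa, hc]
      · rw [Function.update_of_ne hia]
        by_cases hi' : i ∈ Y'
        · have := (add_pos_iff_of_abs_lt (habs i hi')).1
          simp only [orient, Finset.mem_insert, hia, hi', false_or, or_true, if_true, add_apply,
            smul_apply, smul_eq_mul, this]
        · simp [orient, hia, hi']
    rw [h2, h3] at h1
    rw [← h1]
    exact Submodule.smul_mem _ _ (Submodule.subset_span ⟨_, hζ0, hζY, rfl⟩)
  have hadm := admissible_orient hℓ' h0 fun i hi _ => hξY i hi
  rw [← hadm.modeSpline_sub (hX a) (orient_of_mem_line (Finset.mem_insert_self a ℓ))]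
  exact sub_mem (key ε (abs_of_pos hε) _ (by simp [hε]))
    (key (-ε) (by rw [abs_neg, abs_of_pos hε]) _ (by simp [hε.le]))

theorem spaceH_le_span_genSet (hX : ∀ i, X i ≠ 0) (n : ℕ) :
    ∀ ℓ Y : Finset (Fin m), Y.card = n → LinearIndepOn ℝ X (ℓ : Set (Fin m)) →
      (∀ i ∈ Y, X i ∉ Submodule.span ℝ (X '' ℓ)) →
      spaceH 𝕜 X ℓ Y ≤ Submodule.span (SymAlg 𝕜 V) (genSet 𝕜 X ℓ Y) := by
  classical
  induction n using Nat.strong_induction_on with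
  | _ n ih =>
    intro ℓ Y hn hℓ hYℓ f hf
    rcases Y.eq_empty_or_nonempty with rfl | ⟨a, ha⟩
    · have h1 := hf.2 _ (isRational_span_image X ℓ)
        fun i hi => Submodule.subset_span ⟨i, hi, rfl⟩
      rw [Finset.filter_empty, Finset.prod_empty, one_smul] at h1
      refine Submodule.span_mono ?_ (mem_span_modeSpline_line hℓ hf.1 h1)
      exact Set.singleton_subset_iff.2 ⟨0, by simp, by simp, rfl⟩
    -- If r contains X_a, erasing a does not change the product of derivatives; otherwise ∂_a
    -- supplies the missing factor.
    have hderiv : distDeriv 𝕜 (X a) f ∈ spaceH 𝕜 X ℓ (Y.erase a) := by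
      rw [← lin_smul]
      refine ⟨((spaceH 𝕜 X ℓ Y).smul_mem (lin 𝕜 (X a)) hf).1, fun r hr hrℓ => ?_⟩
      by_cases har : X a ∈ r
      · have h2 : (Y.erase a).filter (fun i => X i ∉ r) = Y.filter fun i => X i ∉ r := by
          rw [Finset.filter_erase, Finset.erase_eq_of_notMem]
          simp [har]
        rw [h2]
        exact ((spaceH 𝕜 X ℓ Y).smul_mem (lin 𝕜 (X a)) hf).2 r hr hrℓ
      · rw [smul_smul, Finset.filter_erase, Finset.prod_erase_mul]
        · exact hf.2 r hr hrℓ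
        · exact Finset.mem_filter.2 ⟨ha, har⟩
    obtain ⟨g, hg, hgf⟩ := span_genSet_erase_le hX hℓ ha (hYℓ a ha)
      (ih _ (hn ▸ Finset.card_erase_lt_of_mem ha) ℓ (Y.erase a) rfl hℓ
        (fun i hi => hYℓ i (Finset.mem_of_mem_erase hi)) hderiv)
    have hgf' : distDeriv 𝕜 (X a) g = distDeriv 𝕜 (X a) f := by
      rw [← lin_smul]
      exact hgf
    have hfg : f - g ∈ spaceH 𝕜 X ℓ Y :=
      sub_mem hf (Submodule.span_le.2 (genSet_subset_spaceH hX hℓ) hg)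
    -- A rational r containing ℓ and a contains their span, so discarding the members of Y in that
    -- span changes no condition. It also restores the hypothesis on Y and lowers its cardinality,
    -- since a is discarded.
    have hfg' : f - g ∈ spaceH 𝕜 X (insert a ℓ) (Y.filter fun i =>
        X i ∉ Submodule.span ℝ (X '' (insert a ℓ : Finset (Fin m)))) := by
      refine ⟨fun i hi => ?_, fun r hr hrℓ => ?_⟩
      · rcases Finset.mem_insert.1 hi with rfl | hi
        · rw [map_sub, hgf', sub_self]
        · exact hfg.1 i hi
      · rw [Finset.filter_filter]
        have h3 : (Y.filter fun i => X i ∉ Submodule.span ℝ (X '' (insert a ℓ : Finset (Fin m))) ∧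
            X i ∉ r) = Y.filter fun i => X i ∉ r := by
          refine Finset.filter_congr fun i _ => and_iff_right_of_imp fun h h' => h ?_
          refine Submodule.span_le.2 ?_ h'
          rintro _ ⟨j, hj, rfl⟩
          exact hrℓ j hj
        rw [h3]
        exact hfg.2 r hr fun i hi => hrℓ i (Finset.mem_insert_of_mem hi)
    have h4 := ih _ (hn ▸ Finset.card_lt_card (Finset.filter_ssubset.2 ⟨a, ha, not_not.2
      (Submodule.subset_span ⟨a, Finset.mem_insert_self a ℓ, rfl⟩)⟩)) _ _ rfl
      (by
        rw [Finset.coe_insert]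
        exact hℓ.insert (hYℓ a ha)) (fun i hi => (Finset.mem_filter.1 hi).2) hfg'
    have h5 := Submodule.span_le.2 (genSet_insert_subset (𝕜 := 𝕜) hX hℓ hYℓ ha) h4
    have := add_mem h5 hg
    rwa [sub_add_cancel] at this

end Induction

/-! ### Regular faces and the comparison with their splines. -/

section Faces

variable {𝕜 : Type*} [RCLike 𝕜]

theorem modeSpline_mem_distOn {V : Type*} [NormedAddCommGroup V] [NormedSpace ℝ V] {m : ℕ}
    {X : Fin m → V} {σ : Fin m → Mode} (h : Admissible X σ) {r : Submodule ℝ V}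
    (hr : ∀ i, σ i ≠ Mode.zero → X i ∈ r) : modeSpline 𝕜 X σ ∈ distOn 𝕜 r := by
  classical
  -- The value 0 for the X_i outside r is harmless: their mode is a point, so t_i = 0 on the cone.
  let X' : Fin m → r := fun i => if hi : X i ∈ r then ⟨X i, hi⟩ else 0
  have hX' (t : Fin m → ℝ) (ht : t ∈ paramCone σ) :
      ((∑ i, t i • X' i : r) : V) = ∑ i, t i • X i := by
    rw [Submodule.coe_sum]
    refine Finset.sum_congr rfl fun i _ => ?_
    by_cases hi : X i ∈ r
    · simp [X', hi]
    · have h0 : σ i = Mode.zero := by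
        by_contra hne
        exact hi (hr i hne)
      have : t i = 0 := by simpa [h0, Mode.cone] using ht i
      simp [this]
  have h' : Admissible X' σ := fun t ht hsum => h t ht (by rw [← hX' t ht, hsum]; rfl)
  refine ⟨modeSpline 𝕜 X' σ, ?_⟩
  ext f
  rw [extend_apply, h'.modeSpline_apply, h.modeSpline_apply]
  congr 1
  refine integral_congr_ae ?_
  filter_upwards [ae_mem_paramCone σ] with t ht
  rw [restrict_apply, hX' t ht]

variable {E : Type*} [NormedAddCommGroup E] [NormedSpace ℝ E] {m : ℕ}
  {X : Fin m → StrongDual ℝ E}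

theorem RegularFace.mem_neg_iff (F : RegularFace X) {x : E} (hx : x ∈ F.1) (i : Fin m) :
    i ∈ F.neg ↔ X i x < 0 := by
  simp only [RegularFace.neg, Finset.mem_filter, Finset.mem_univ, true_and]
  exact ⟨fun h => h x hx, fun h => (F.sign i).resolve_left fun h' => (h' x hx).not_gt h⟩

theorem RegularFace.ne_zero (F : RegularFace X) {x : E} (hx : x ∈ F.1) (i : Fin m) :
    X i x ≠ 0 := by
  rcases F.sign i with h | h
  · exact (h x hx).ne'
  · exact (h x hx).ne

theorem measurePreserving_neg_Ici_Iic :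
    MeasurePreserving (fun s : ℝ => -s) (volume.restrict (Set.Ici 0))
      (volume.restrict (Set.Iic 0)) := by
  have h := (Measure.measurePreserving_neg (volume : Measure ℝ)).restrict_preimage
    (measurableSet_Iic (a := (0 : ℝ)))
  have h2 : (Neg.neg ⁻¹' Set.Iic (0 : ℝ)) = Set.Ici 0 := by ext; simp
  rwa [h2] at h

theorem restrict_orthant :
    (volume : Measure (Fin m → ℝ)).restrict (orthant m) =
      Measure.pi fun _ => volume.restrict (Set.Ici 0) := by
  have h : orthant m = Set.univ.pi fun _ => Set.Ici (0 : ℝ) := by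
    ext t
    simp [orthant, Pi.le_def]
  rw [h, volume_pi, Measure.restrict_pi_pi]

/-- The substitution t_i ↦ -t_i for the members of B trades -X_i on a positive half-line for X_i on
a negative one, and (-1)^|B| is the product of the weights. -/
theorem faceSpline_eq_modeSpline (F : RegularFace X) {x : E} (hx : x ∈ F.1) :
    faceSpline 𝕜 X F =
      modeSpline 𝕜 X (orient X (ContinuousLinearMap.apply ℝ ℝ x) ∅ Finset.univ) := by
  classical
  have hσ (i : Fin m) : orient X (ContinuousLinearMap.apply ℝ ℝ x) ∅ Finset.univ i =
      if i ∈ F.neg then Mode.neg else Mode.pos := by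
    rcases (F.ne_zero hx i).lt_or_gt with h | h <;>
      simp [orient, F.mem_neg_iff hx, h, h.not_gt]
  have hadm : Admissible X (orient X (ContinuousLinearMap.apply ℝ ℝ x) ∅ Finset.univ) :=
    admissible_orient (by simp) (by simp) fun i _ _ => F.ne_zero hx i
  ext f
  rw [hadm.modeSpline_apply]
  have hw : (-1 : 𝕜) ^ F.neg.card = ∏ i, Mode.weight 𝕜
      (orient X (ContinuousLinearMap.apply ℝ ℝ x) ∅ Finset.univ i) := by
    have (i : Fin m) : Mode.weight 𝕜 (orient X (ContinuousLinearMap.apply ℝ ℝ x) ∅ Finset.univ i) =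
        if i ∈ F.neg then -1 else 1 := by
      rw [hσ]
      split_ifs <;> rfl
    simp [this]
  have hmp : MeasurePreserving (fun (t : Fin m → ℝ) i => if i ∈ F.neg then -t i else t i)
      (Measure.pi fun _ => volume.restrict (Set.Ici 0))
      (paramMeasure (orient X (ContinuousLinearMap.apply ℝ ℝ x) ∅ Finset.univ)) := by
    refine measurePreserving_pi (f := fun i s => if i ∈ F.neg then -s else s) _ _ fun i => ?_
    rw [hσ]
    split_ifs
    · exact measurePreserving_neg_Ici_Iic
    · exact MeasurePreserving.id _
  have hc : Continuous fun t : Fin m → ℝ => f (∑ i, t i • X i) := f.continuous.comp (by fun_prop)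
  rw [← hmp.map_eq, integral_map hmp.measurable.aemeasurable hc.aestronglyMeasurable, ← hw,
    ← restrict_orthant]
  change (-1 : 𝕜) ^ F.neg.card * spline 𝕜 F.flip F.flip_pos f = _
  rw [spline_apply]
  congr 1
  refine integral_congr_ae (Filter.Eventually.of_forall fun t => ?_)
  change f _ = f _
  congr 1
  refine Finset.sum_congr rfl fun i _ => ?_
  by_cases hi : i ∈ F.neg
  · simp only [RegularFace.flip, hi, if_true]
    exact (smul_neg (t i) (X i)).trans (neg_smul (t i) (X i)).symm
  · simp only [RegularFace.flip, hi, if_false]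

theorem RegularFace.exists_mem (F : RegularFace X) : ∃ x, x ∈ F.1 := by
  obtain ⟨F, y, hy, rfl⟩ := F
  exact ⟨y, mem_connectedComponentIn hy⟩

theorem faceSpline_mem_spaceG (hX : ∀ i, X i ≠ 0) (F : RegularFace X) :
    faceSpline 𝕜 X F ∈ spaceG 𝕜 X := by
  classical
  obtain ⟨x, hx⟩ := F.exists_mem
  intro r _
  have hne (i : Fin m) : (ContinuousLinearMap.apply ℝ ℝ x) (X i) ≠ 0 := F.ne_zero hx i
  rw [faceSpline_eq_modeSpline F hx, dSdiff, prod_lin_smul_modeSpline_orient hX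
    (admissible_orient (by simp) (by simp) fun i _ _ => hne i) (Finset.filter_subset _ _)
    (Finset.disjoint_empty_right _)]
  refine modeSpline_mem_distOn (admissible_orient (by simp) (by simp) fun i _ _ => hne i)
    fun i hi => ?_
  by_contra hir
  exact hi (orient_of_notMem (Finset.notMem_empty i) (by simp [hir]))

theorem spaceG_subset_spaceH : (spaceG 𝕜 X : Set (TempDist 𝕜 (StrongDual ℝ E))) ⊆
    spaceH 𝕜 X ∅ Finset.univ :=
  fun _ hf => ⟨by simp, fun r hr _ => distOn_subset_nearDist r (hf r hr)⟩

theorem exists_eq_apply [FiniteDimensional ℝ E] (ξ : StrongDual ℝ E →L[ℝ] ℝ) :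
    ∃ x : E, ξ = ContinuousLinearMap.apply ℝ ℝ x := by
  let ψ : Module.Dual ℝ (Module.Dual ℝ E) :=
    ξ.toLinearMap ∘ₗ LinearMap.toContinuousLinearMap.toLinearMap
  refine ⟨(Module.evalEquiv ℝ E).symm ψ, ?_⟩
  ext a
  have h := Module.apply_evalEquiv_symm_apply (R := ℝ) (M := E) a.toLinearMap ψ
  exact h.symm

/-- By biduality ξ is evaluation at a point x of 𝔤. Since ξ vanishes on no X_i, x is regular, and
the face containing it gives the spline. -/
theorem genSet_subset_iSup [FiniteDimensional ℝ E] :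
    genSet 𝕜 X ∅ Finset.univ ⊆
      (⨆ F : RegularFace X, Submodule.span (SymAlg 𝕜 (StrongDual ℝ E)) {faceSpline 𝕜 X F} :
        Submodule (SymAlg 𝕜 (StrongDual ℝ E)) (TempDist 𝕜 (StrongDual ℝ E))) := by
  rintro _ ⟨ξ, -, hξ, rfl⟩
  obtain ⟨x, rfl⟩ := exists_eq_apply ξ
  have hx : x ∈ arrangementCompl X := fun i => hξ i (Finset.mem_univ i)
  let F : RegularFace X := ⟨connectedComponentIn (arrangementCompl X) x, x, hx, rfl⟩
  rw [← faceSpline_eq_modeSpline F (mem_connectedComponentIn hx)]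
  exact Submodule.mem_iSup_of_mem F (Submodule.mem_span_singleton_self _)

end Faces

end SplineModule

end

theorem mainTheorem9 {𝕜 : Type*} [RCLike 𝕜]
    {𝔤 : Type*} [NormedAddCommGroup 𝔤] [NormedSpace ℝ 𝔤] [FiniteDimensional ℝ 𝔤]
    {m : ℕ} (X : Fin m → StrongDual ℝ 𝔤) (hX : ∀ i, X i ≠ 0)
    (hspan : Submodule.span ℝ (Set.range X) = ⊤) :
    SplineModule.tildeG 𝕜 X =
      ⨆ F : SplineModule.RegularFace X,
        Submodule.span (SplineModule.SymAlg 𝕜 (StrongDual ℝ 𝔤))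
          {SplineModule.faceSpline 𝕜 X F} := by
  refine le_antisymm (Submodule.span_le.2 fun f hf => ?_) (iSup_le fun F => ?_)
  -- The induction starts with no invariant direction and all of X; nonvanishing of the X_i says
  -- that none lies in the span of the empty family.
  · have h := SplineModule.spaceH_le_span_genSet hX _ ∅ Finset.univ rfl (by simp)
      (fun i _ => by simpa using hX i) (SplineModule.spaceG_subset_spaceH hf)
    exact Submodule.span_le.2 SplineModule.genSet_subset_iSup h
  · rw [Submodule.span_singleton_le_iff_mem]
    exact Submodule.subset_span (SplineModule.faceSpline_mem_spaceG hX F)
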